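/- Conventions. A continuum is a non-empty compact connected metrizable space; a dendroid is an arcwise connected continuum all of whose subcontinua $Y$ are unicoherent (if $Y=A\cup B$ with subcontinua $A,B$, then $A\cap B$ is connected); a fan is a dendroid with at most one ramification point (top of a simple triod), which, if it exists, is called its top. In a fan $Z$, $A_Z[x,y]$ denotes the arc with end-points $x\ne y$, and $A_Z[x,x]=\{x\}$; $E(Z)$ is the set of points that are an end-point of every arc of $Z$ containing them. The legs of a fan $Z$ with top $v$ are the arcs $A_Z[v,e]$, $e\in E(Z)$. The fan $Z$ with top $v$ is smooth if $x_n\to x$ always implies $A_Z[v,x_n]\to A_Z[v,x]$ in the Hausdorff metric. A homeomorphism $\varphi:Z\to Z$ is transitive if for all non-empty open $U,V\subseteq Z$ some $\varphi^n(U)$, $n\ge 0$, meets $V$. The Cantor fan $F\subseteq\mathbb R^2$ is the union of the segments from $(0,0)$ to $(c,1)$, $c$ in the standard Cantor set. Theorem. Let $F_\lambda\subseteq F$ be a smooth fan, let $\varphi_\lambda:F_\lambda\to F_\lambda$ be a transitive homeomorphism, and let $A_\lambda$ be a leg of $F_\lambda$ such that $\varphi_\lambda(x)=x$ for every $x\in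 A_\lambda$. Let $a_\lambda$ be the point with $E(F_\lambda)\cap A_\lambda=\{a_\lambda\}$, let $\sim_\lambda$ be the equivalence relation on $F_\lambda$ for which $x\sim_\lambda y$ if and only if $x=y$ or $x=t a_\lambda$, $y=(1-t)a_\lambda$ for some $t\in[0,1]$, let $J_\lambda=F_\lambda/{\sim_\lambda}$ with the quotient topology, let $q_\lambda:F_\lambda\to J_\lambda$ be the quotient map, and let $L_{a_\lambda}=\{q_\lambda(t a_\lambda)\mid t\in[0,1]\}$. Then $J_\lambda$ is a fan, and it is not smooth. More precisely: 1. The top of $J_\lambda$ is $o=q_\lambda((0,0))$; $L_{a_\lambda}$ is an arc with end-points $o$ and $q_\lambda(\tfrac12 a_\lambda)$; the point $p=q_\lambda(\tfrac34 a_\lambda)$ lies on $L_{a_\lambda}$ and is different from both end-points; and $A_{J_\lambda}[o,p]\subsetneq L_{a_\lambda}$. 2. There are pairwise different end-points $e_k\in E(F_\lambda)\setminus\{a_\lambda\}$ and points $x_k\in A_{F_\lambda}[(0,0),e_k]\setminus\{(0,0),e_k\}$, $k\in\mathbb N$, with $x_k\to\tfrac34 a_\lambda$. 3. For every sequence $(x_k)$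 in $F_\lambda\setminus A_\lambda$ with $x_k\to\tfrac34 a_\lambda$, one has $q_\lambda(x_k)\to p$, and the arcs $A_{J_\lambda}[o,q_\lambda(x_k)]$ converge in the Hausdorff metric to the whole of $L_{a_\lambda}$, and do not converge to $A_{J_\lambda}[o,p]$. -/

import Mathlib

open Set Filter Topology

noncomputable section

namespace FoldedFan

/-! ### Continua, arcs, dendroids and fans -/

/-- A continuum: a non-empty compact connected metrizable space. -/
def IsContinuum (X : Type*) [TopologicalSpace X] : Prop :=
  TopologicalSpace.MetrizableSpace X ∧ CompactSpace X ∧ ConnectedSpace X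

/-- `X` is unicoherent: whenever `X` is the union of two subcontinua, their intersection is
connected. -/
def IsUnicoherent (X : Type*) [TopologicalSpace X] : Prop :=
  ∀ A B : Set X, IsContinuum A → IsContinuum B → A ∪ B = univ → IsConnected (A ∩ B)

/-- Every subcontinuum of `X` is unicoherent. -/
def IsHereditarilyUnicoherent (X : Type*) [TopologicalSpace X] : Prop :=
  ∀ S : Set X, IsContinuum S → IsUnicoherent S

section
variable {X : Type*} [TopologicalSpace X]

/-- `S` is an arc in `X`. -/
def IsArc (S : Set X) : Prop :=
  Nonempty (unitInterval ≃ₜ S)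

/-- `x` is an end-point of the arc `S`. -/
def IsEndPointOfArc (S : Set X) (x : X) : Prop :=
  ∃ h : unitInterval ≃ₜ S, (h 0 : X) = x

/-- `S` is an arc in `X` with end-points `x` and `y` if `x ≠ y`, and `S = {x}` if `x = y`. -/
def IsArcBetween (S : Set X) (x y : X) : Prop :=
  (x = y ∧ S = {x}) ∨ ∃ h : unitInterval ≃ₜ S, (h 0 : X) = x ∧ (h 1 : X) = y

/-- `A_X[x, y]`: the arc in `X` with end-points `x` and `y` (the set `{x}` if `x = y`). It exists
and is unique when `X` is a dendroid; the definition is only used for dendroids. -/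
def arc (x y : X) : Set X :=
  Classical.epsilon fun S => IsArcBetween S x y

end

/-- A dendroid: an arcwise connected, hereditarily unicoherent continuum. -/
def IsDendroid (X : Type*) [TopologicalSpace X] : Prop :=
  IsContinuum X ∧ (∀ x y : X, ∃ S : Set X, IsArcBetween S x y) ∧ IsHereditarilyUnicoherent X

/-- The end-points `E(X)` of a dendroid `X`: the points that are an end-point of every arc in `X`
containing them. -/
def endPoints (X : Type*) [TopologicalSpace X] : Set X :=
  {x | ∀ S : Set X, IsArc S → x ∈ S → IsEndPointOfArc S x}

/-- The model simple triod `([-1,1] × {0}) ∪ ({0} × [0,1])` in the plane. -/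
def triod : Set (ℝ × ℝ) :=
  (Icc (-1) 1 ×ˢ {0}) ∪ ({0} ×ˢ Icc 0 1)

/-- `x` is the top of a simple triod contained in `X`. -/
def IsRamificationPoint {X : Type*} [TopologicalSpace X] (x : X) : Prop :=
  ∃ (T : Set X) (h : triod ≃ₜ T), ∃ c : triod, (c : ℝ × ℝ) = (0, 0) ∧ (h c : X) = x

/-- A fan: a dendroid with at most one ramification point. -/
def IsFan (X : Type*) [TopologicalSpace X] : Prop :=
  IsDendroid X ∧ ∀ v w : X, IsRamificationPoint v → IsRamificationPoint w → v = w

/-- `X` is a fan and `v` is its top, that is, its ramification point. -/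
def IsFanWithTop (X : Type*) [TopologicalSpace X] (v : X) : Prop :=
  IsFan X ∧ IsRamificationPoint v

/-- Convergence of the sets `A n` to `B` in the Hausdorff metric. The Hausdorff distance is taken
for every metric inducing the topology of `X`; for closed subsets of a compact metrizable space the
convergence does not depend on this metric. -/
def HausdorffTendsto {X : Type*} [t : TopologicalSpace X] (A : ℕ → Set X) (B : Set X) : Prop :=
  ∀ m : MetricSpace X, m.toPseudoMetricSpace.toUniformSpace.toTopologicalSpace = t →
    Tendsto (fun n => Metric.hausdorffEDist (A n) B) atTop (𝓝 0)

/-- `X` is a smooth fan: it is a fan with a top `v`, and `x n → x` implies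
`A_X[v, x n] → A_X[v, x]` in the Hausdorff metric. -/
def IsSmoothFan (X : Type*) [TopologicalSpace X] : Prop :=
  ∃ v : X, IsFanWithTop X v ∧ ∀ (x : X) (xs : ℕ → X), Tendsto xs atTop (𝓝 x) →
    HausdorffTendsto (fun n => arc v (xs n)) (arc v x)

/-- `A` is a leg of the fan `X`: the arc from the top to an end-point of `X`. -/
def IsLeg {X : Type*} [TopologicalSpace X] (A : Set X) : Prop :=
  ∃ v e : X, IsFanWithTop X v ∧ e ∈ endPoints X ∧ A = arc v e

/-- `f` is transitive: for all non-empty open `U`, `V` some `f^n(U)`, `n ≥ 0`, meets `V`. -/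
def IsTransitiveMap {X : Type*} [TopologicalSpace X] (f : X → X) : Prop :=
  ∀ U V : Set X, IsOpen U → IsOpen V → U.Nonempty → V.Nonempty →
    ∃ n : ℕ, ((f^[n] '' U) ∩ V).Nonempty

/-- The Cantor fan `F`: the union of the straight segments from `(0, 0)` to `(c, 1)`, where `c`
runs through the standard Cantor set. -/
def cantorFan : Set (ℝ × ℝ) :=
  ⋃ c ∈ cantorSet, segment ℝ ((0, 0) : ℝ × ℝ) (c, 1)

/-! ### Folding a leg -/

/-- The relation on `X` that identifies `t • a` with `(1 - t) • a` for every `t ∈ [0, 1]`. -/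
def foldSetoid (X : Set (ℝ × ℝ)) (a : ℝ × ℝ) : Setoid X where
  r x y := x = y ∨ ∃ t ∈ Icc (0 : ℝ) 1, (x : ℝ × ℝ) = t • a ∧ (y : ℝ × ℝ) = (1 - t) • a
  iseqv := by
    refine ⟨fun x => Or.inl rfl, ?_, ?_⟩
    · rintro x y (rfl | ⟨t, ht, hx, hy⟩)
      · exact Or.inl rfl
      · exact Or.inr ⟨1 - t, ⟨by linarith [ht.2], by linarith [ht.1]⟩, hy, by simpa using hx⟩
    · rintro x y z (rfl | ⟨t, ht, hx, hy⟩) hyz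
      · exact hyz
      · rcases hyz with rfl | ⟨s, hs, hy', hz⟩
        · exact Or.inr ⟨t, ht, hx, hy⟩
        · left
          apply Subtype.ext
          rw [hx, hz, sub_smul, ← hy', hy, sub_smul]
          simp

/-- The quotient space `J = X / ∼` with the quotient topology. -/
abbrev FoldedSpace (X : Set (ℝ × ℝ)) (a : ℝ × ℝ) : Type :=
  Quotient (foldSetoid X a)

/-- The quotient map `q : X → J`. -/
def foldMap (X : Set (ℝ × ℝ)) (a : ℝ × ℝ) (x : X) : FoldedSpace X a :=
  Quotient.mk (foldSetoid X a) x

/-- The folded arc `L_a = {[t • a] | t ∈ [0, 1]}` in `J`. -/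
def foldedArc (X : Set (ℝ × ℝ)) (a : ℝ × ℝ) : Set (FoldedSpace X a) :=
  foldMap X a '' {x : X | ∃ t ∈ Icc (0 : ℝ) 1, (x : ℝ × ℝ) = t • a}

end FoldedFan

end

open FoldedFan

namespace FoldedFan

/-! ### Arcs in hereditarily unicoherent spaces -/

/-! A fan with a top inside the Cantor fan is star-shaped about the origin
(`isRadial_of_isDendroid`): an arc leaving the origin never returns there, so its slope stays in a
totally disconnected set and is constant. Its legs are therefore straight segments, and the given
leg is `[0, a]`.

Folding identifies `t • a` with `(1 - t) • a`, so the leg `[0, a]` becomes the image of `[0, a /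
2]`, while every other leg is mapped injectively. Three polynomials separate exactly the classes,
which embeds the quotient in `ℝ³` (`exists_foldCoord`). Away from the top `o` the slope is still
continuous with values in the Cantor set, and each of its fibres together with `o` is an arc. This
alone gives a fan (`IsLegSystem.isFan`): clopen subsets of the Cantor set separate the legs, so a
subcontinuum meets each leg in an interval (`IsLegSystem.ordConnected`); hereditary unicoherence and
uniqueness of the ramification point follow.

For non-smoothness, a transitive map cannot fix more than one point of an open set on which it is
the identity. The fixed leg thus has empty interior, and `3/4 • a` is a limit of points `x k` on
other legs. The segments `[0, x k]` converge uniformly to `[0, 3/4 • a]`, whose image runs up the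
folded arc to the image of `1/2 • a` and part of the way back, so it is the whole folded arc. But
the arc from `o` to the limit point is only the image of `[0, 1/4 • a]`. -/

theorem isContinuum_iff {X : Type*} [TopologicalSpace X] [TopologicalSpace.MetrizableSpace X]
    (S : Set X) : IsContinuum S ↔ IsCompact S ∧ IsConnected S := by
  rw [IsContinuum, isCompact_iff_compactSpace, isConnected_iff_connectedSpace]
  exact ⟨fun h => h.2, fun h => ⟨inferInstance, h⟩⟩

/-- For the forward direction the subcontinuum is `A ∪ B`. Conversely, two non-empty closed sets
covering a connected space must meet. This form avoids nested subtypes. -/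
theorem isHereditarilyUnicoherent_iff {X : Type*} [TopologicalSpace X]
    [TopologicalSpace.MetrizableSpace X] :
    IsHereditarilyUnicoherent X ↔ ∀ A B : Set X, IsCompact A → IsConnected A → IsCompact B →
      IsConnected B → (A ∩ B).Nonempty → IsConnected (A ∩ B) := by
  constructor
  · intro h A B hA hA' hB hB' hAB
    have key := h (A ∪ B) ((isContinuum_iff _).2 ⟨hA.union hB, hA'.union hAB hB'⟩)
      (Subtype.val ⁻¹' A) (Subtype.val ⁻¹' B)
    have im : ∀ T ⊆ A ∪ B, Subtype.val '' (Subtype.val ⁻¹' T : Set ↥(A ∪ B)) = T := by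
      intro T hT
      rw [Subtype.image_preimage_coe, inter_eq_right.2 hT]
    have cont : ∀ T ⊆ A ∪ B, IsCompact T → IsConnected T →
        IsContinuum (Subtype.val ⁻¹' T : Set ↥(A ∪ B)) := by
      intro T hT hc hc'
      refine (isContinuum_iff _).2 ⟨?_, ?_, ?_⟩
      · rw [IsInducing.subtypeVal.isCompact_iff, im T hT]; exact hc
      · obtain ⟨x, hx⟩ := hc'.1
        exact ⟨⟨x, hT hx⟩, hx⟩
      · rw [← IsInducing.subtypeVal.isPreconnected_image, im T hT]; exact hc'.2
    have := (key (cont A subset_union_left hA hA') (cont B subset_union_right hB hB')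
      (by ext x; simpa using show (x : X) ∈ A ∨ (x : X) ∈ B from x.2)).image _ continuous_subtype_val.continuousOn
    rwa [← preimage_inter, im _ (inter_subset_left.trans subset_union_left)] at this
  · intro h S hS A B hA hB hAB
    obtain ⟨-, hc, hcon⟩ := hS
    rw [isContinuum_iff] at hA hB
    have cA : IsClosed A := hA.1.isClosed
    have cB : IsClosed B := hB.1.isClosed
    have ne : (A ∩ B).Nonempty := by
      have := isPreconnected_closed_iff.1 (isPreconnected_univ (α := S)) A B cA cB hAB.ge
        (by simpa using hA.2.1) (by simpa using hB.2.1)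
      simpa using this
    have := h (Subtype.val '' A) (Subtype.val '' B) (hA.1.image continuous_subtype_val)
      (hA.2.image _ continuous_subtype_val.continuousOn) (hB.1.image continuous_subtype_val)
      (hB.2.image _ continuous_subtype_val.continuousOn)
      (by rw [← image_inter Subtype.val_injective]; exact ne.image _)
    rw [← image_inter Subtype.val_injective] at this
    exact ⟨ne, IsInducing.subtypeVal.isPreconnected_image.1 this.2⟩

section
variable {X : Type*} [TopologicalSpace X]

theorem isArcBetween_range [T2Space X] {f : unitInterval → X} (hf : Continuous f)
    (hi : f.Injective) : IsArcBetween (range f) (f 0) (f 1) :=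
  .inr ⟨(hf.isClosedEmbedding hi).isEmbedding.toHomeomorph, rfl, rfl⟩

theorem isArcBetween_image [T2Space X] {f : ℝ → X} {p q : ℝ} (h : p ≤ q)
    (hf : ContinuousOn f (Icc p q)) (hi : InjOn f (Icc p q)) :
    IsArcBetween (f '' Icc p q) (f p) (f q) := by
  rcases h.eq_or_lt with rfl | h
  · exact .inl ⟨rfl, by simp⟩
  have := isArcBetween_range (f := fun t => f ((iccHomeoI p q h).symm t))
    (hf.comp_continuous (by fun_prop) fun t => Subtype.coe_prop _)
    (fun s t hst => (iccHomeoI p q h).symm.injective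
      (Subtype.ext (hi (Subtype.coe_prop _) (Subtype.coe_prop _) hst)))
  have hr : range (fun t => f ((iccHomeoI p q h).symm t)) = f '' Icc p q := by
    ext z
    constructor
    · rintro ⟨t, rfl⟩
      exact ⟨_, Subtype.coe_prop _, rfl⟩
    · rintro ⟨t, ht, rfl⟩
      exact ⟨iccHomeoI p q h ⟨t, ht⟩, by simp only [Homeomorph.symm_apply_apply]⟩
  rw [hr] at this
  simpa using this

theorem IsArcBetween.symm {S : Set X} {x y : X} (h : IsArcBetween S x y) :
    IsArcBetween S y x := by
  rcases h with ⟨rfl, rfl⟩ | ⟨h, hx, hy⟩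
  · exact .inl ⟨rfl, rfl⟩
  · exact .inr ⟨unitInterval.symmHomeomorph.trans h, by simpa using hy, by simpa using hx⟩

theorem IsArcBetween.isCompact {S : Set X} {x y : X} (h : IsArcBetween S x y) : IsCompact S := by
  rcases h with ⟨rfl, rfl⟩ | ⟨h, -⟩
  · exact isCompact_singleton
  · exact isCompact_iff_compactSpace.2 h.compactSpace

theorem IsArcBetween.isConnected {S : Set X} {x y : X} (h : IsArcBetween S x y) :
    IsConnected S := by
  rcases h with ⟨rfl, rfl⟩ | ⟨h, -⟩
  · exact isConnected_singleton
  · rw [← Subtype.range_coe (s := S), ← h.surjective.range_comp]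
    exact isConnected_range (continuous_subtype_val.comp h.continuous)

theorem IsArcBetween.left_mem {S : Set X} {x y : X} (h : IsArcBetween S x y) : x ∈ S := by
  rcases h with ⟨rfl, rfl⟩ | ⟨h, rfl, -⟩
  · rfl
  · exact Subtype.coe_prop _

theorem IsArcBetween.subset_of_isPreconnected {S T : Set X} {x y : X} (h : IsArcBetween S x y)
    (hT : IsPreconnected T) (hTS : T ⊆ S) (hx : x ∈ T) (hy : y ∈ T) : S ⊆ T := by
  rcases h with ⟨rfl, rfl⟩ | ⟨h, rfl, rfl⟩
  · simpa using hx
  · have hpre : IsPreconnected ((fun t => (h t : X)) ⁻¹' T) := by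
      have hemb : IsInducing (fun t => (h t : X)) :=
        IsInducing.subtypeVal.comp h.isInducing
      rw [← hemb.isPreconnected_image, image_preimage_eq_of_subset]
      · exact hT
      · intro z hz
        exact ⟨h.symm ⟨z, hTS hz⟩, by simp⟩
    intro z hz
    have := hpre.ordConnected.out (x := 0) hx (y := 1) hy (show h.symm ⟨z, hz⟩ ∈ Icc 0 1 from
      ⟨unitInterval.nonneg _, unitInterval.le_one _⟩)
    simpa using this

/-- The intersection of the two arcs is connected and contains both end-points, and no proper subset
of an arc has these two properties. -/
theorem IsArcBetween.unique [TopologicalSpace.MetrizableSpace X]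
    (hX : IsHereditarilyUnicoherent X) {S T : Set X} {x y : X} (hS : IsArcBetween S x y)
    (hT : IsArcBetween T x y) : S = T := by
  have h := isHereditarilyUnicoherent_iff.1 hX S T hS.isCompact hS.isConnected hT.isCompact
    hT.isConnected ⟨x, hS.left_mem, hT.left_mem⟩
  have hx : x ∈ S ∩ T := ⟨hS.left_mem, hT.left_mem⟩
  have hy : y ∈ S ∩ T := ⟨hS.symm.left_mem, hT.symm.left_mem⟩
  exact ((hS.subset_of_isPreconnected h.2 inter_subset_left hx hy).trans inter_subset_right).antisymm
    ((hT.subset_of_isPreconnected h.2 inter_subset_right hx hy).trans inter_subset_left)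

theorem IsDendroid.arc_eq (hX : IsDendroid X) {S : Set X} {x y : X} (hS : IsArcBetween S x y) :
    arc x y = S := by
  have := hX.1.1
  exact (Classical.epsilon_spec (p := fun S => IsArcBetween S x y) ⟨S, hS⟩).unique hX.2.2 hS

/-- Removing an end-point leaves an arc connected; removing `f s` with `p < s < q` disconnects it.
-/
theorem not_isEndPointOfArc_image [T2Space X] {f : ℝ → X} {p q s : ℝ}
    (hf : ContinuousOn f (Icc p q)) (hi : InjOn f (Icc p q)) (hs : s ∈ Ioo p q) :
    ¬ IsEndPointOfArc (f '' Icc p q) (f s) := by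
  rintro ⟨h, h0⟩
  have hpq : p < q := hs.1.trans hs.2
  have hpre : IsPreconnected (f '' Icc p q \ {f s}) := by
    have : f '' Icc p q \ {f s} = (fun t => (h t : X)) '' Ioc 0 1 := by
      ext z
      constructor
      · rintro ⟨hz, hne⟩
        refine ⟨h.symm ⟨z, hz⟩, ⟨?_, unitInterval.le_one _⟩, by simp⟩
        rw [unitInterval.pos_iff_ne_zero]
        intro h'
        apply hne
        rw [← h0, ← h', h.apply_symm_apply]; rfl
      · rintro ⟨t, ht, rfl⟩
        refine ⟨Subtype.coe_prop _, fun h' => ht.1.ne' ?_⟩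
        rw [mem_singleton_iff, ← h0] at h'
        exact h.injective (Subtype.ext h')
    rw [this]
    exact isPreconnected_Ioc.image _ (by fun_prop)
  have hemb : IsInducing ((Icc p q).domRestrict f) :=
    (hf.domRestrict.isClosedEmbedding (injOn_iff_injective.1 hi)).isInducing
  have him : f '' Icc p q \ {f s} = (Icc p q).domRestrict f '' {t | (t : ℝ) ≠ s} := by
    ext z
    constructor
    · rintro ⟨⟨t, ht, rfl⟩, hne⟩
      exact ⟨⟨t, ht⟩, fun h' => hne (congrArg f h'), rfl⟩
    · rintro ⟨t, ht, rfl⟩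
      exact ⟨⟨t, t.2, rfl⟩, fun h' => ht (hi t.2 (Ioo_subset_Icc_self hs) h')⟩
  rw [him, hemb.isPreconnected_image] at hpre
  have h' := hpre.ordConnected.out (x := ⟨p, left_mem_Icc.2 hpq.le⟩) hs.1.ne
    (y := ⟨q, right_mem_Icc.2 hpq.le⟩) hs.2.ne'
  exact @h' ⟨s, Ioo_subset_Icc_self hs⟩ ⟨hs.1.le, hs.2.le⟩ rfl

theorem not_mem_endPoints_of_interior [T2Space X] {f : ℝ → X} {p q s : ℝ}
    (hf : ContinuousOn f (Icc p q)) (hi : InjOn f (Icc p q)) (hs : s ∈ Ioo p q) :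
    f s ∉ endPoints X := by
  intro h
  refine not_isEndPointOfArc_image hf hi hs (h _ ?_ ⟨s, Ioo_subset_Icc_self hs, rfl⟩)
  have hpq : p < q := hs.1.trans hs.2
  rcases isArcBetween_image hpq.le hf hi with ⟨h', -⟩ | ⟨h', -⟩
  · exact absurd (hi (left_mem_Icc.2 hpq.le) (right_mem_Icc.2 hpq.le) h') hpq.ne
  · exact ⟨h'⟩

end

/-! ### Ramification points -/

/-- Trades the planar model for a bar `f` and a stem `g`. Compactness of the triod makes a
continuous injection on it an embedding. -/
theorem isRamificationPoint_iff {X : Type*} [TopologicalSpace X] [T2Space X] {x : X} :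
    IsRamificationPoint x ↔ ∃ f g : ℝ → X, ContinuousOn f (Icc (-1) 1) ∧ InjOn f (Icc (-1) 1) ∧
      ContinuousOn g (Icc 0 1) ∧ InjOn g (Icc 0 1) ∧ f 0 = x ∧ g 0 = x ∧
      ∀ s ∈ Icc (-1 : ℝ) 1, ∀ t ∈ Ioc (0 : ℝ) 1, f s ≠ g t := by
  constructor
  · rintro ⟨T, h, c, hc, rfl⟩
    have hf : ∀ s : ℝ, ((max (-1) (min 1 s), 0) : ℝ × ℝ) ∈ triod := fun s =>
      .inl ⟨⟨le_max_left _ _, max_le (by norm_num) (min_le_left _ _)⟩, rfl⟩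
    have hg : ∀ t : ℝ, ((0, max 0 (min 1 t)) : ℝ × ℝ) ∈ triod := fun t =>
      .inr ⟨rfl, ⟨le_max_left _ _, max_le (by norm_num) (min_le_left _ _)⟩⟩
    have ef : ∀ s ∈ Icc (-1 : ℝ) 1, max (-1) (min 1 s) = s := fun s hs => by
      rw [min_eq_right hs.2, max_eq_right hs.1]
    have eg : ∀ s ∈ Icc (0 : ℝ) 1, max 0 (min 1 s) = s := fun s hs => by
      rw [min_eq_right hs.2, max_eq_right hs.1]
    have inj : ∀ {p q : triod}, (h p : X) = h q → (p : ℝ × ℝ) = q := fun hpq =>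
      congrArg _ (h.injective (Subtype.ext hpq))
    refine ⟨fun s => h ⟨_, hf s⟩, fun t => h ⟨_, hg t⟩, by fun_prop, ?_, by fun_prop, ?_, ?_, ?_, ?_⟩
    · intro s hs t ht hst
      have := congrArg Prod.fst (inj hst)
      simpa only [ef s hs, ef t ht] using this
    · intro s hs t ht hst
      have := congrArg Prod.snd (inj hst)
      simpa only [eg s hs, eg t ht] using this
    · exact congrArg (fun p => (h p : X)) (Subtype.ext (by simp [hc]))
    · exact congrArg (fun p => (h p : X)) (Subtype.ext (by simp [hc]))
    · intro s hs t ht hst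
      have := congrArg Prod.snd (inj hst)
      simp only [eg t (Ioc_subset_Icc_self ht)] at this
      exact ht.1.ne this
  · rintro ⟨f, g, hf, hfi, hg, hgi, f0, g0, hfg⟩
    set G : ℝ × ℝ → X := fun p => if p.2 = 0 then f p.1 else g p.2 with hG
    have G1 : ∀ s, G (s, 0) = f s := fun s => by simp [hG]
    have G2 : ∀ t, G (0, t) = g t := fun t => by
      by_cases ht : t = 0
      · simp [hG, ht, f0, g0]
      · simp [hG, ht]
    have cl1 : IsClosed (Icc (-1 : ℝ) 1 ×ˢ ({0} : Set ℝ)) := isClosed_Icc.prod isClosed_singleton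
    have cl2 : IsClosed (({0} : Set ℝ) ×ˢ Icc (0 : ℝ) 1) := isClosed_singleton.prod isClosed_Icc
    have hcomp : CompactSpace triod := isCompact_iff_compactSpace.1
      ((isCompact_Icc.prod isCompact_singleton).union (isCompact_singleton.prod isCompact_Icc))
    have cG : ContinuousOn G triod := by
      refine ContinuousOn.union_of_isClosed ?_ ?_ cl1 cl2
      · refine (hf.comp continuousOn_fst fun p hp => hp.1).congr ?_
        rintro ⟨s, t⟩ ⟨-, rfl⟩
        exact G1 s
      · refine (hg.comp continuousOn_snd fun p hp => hp.2).congr ?_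
        rintro ⟨s, t⟩ ⟨rfl, -⟩
        exact G2 t
    have iG : InjOn G triod := by
      have pos : ∀ {t : ℝ}, t ∈ Icc (0 : ℝ) 1 → t = 0 ∨ t ∈ Ioc (0 : ℝ) 1 := fun {t} ht =>
        ht.1.eq_or_lt.imp Eq.symm fun h => ⟨h, ht.2⟩
      have cross : ∀ s ∈ Icc (-1 : ℝ) 1, ∀ t ∈ Icc (0 : ℝ) 1, f s = g t →
          ((s, 0) : ℝ × ℝ) = (0, t) := by
        intro s hs t ht h
        rcases pos ht with rfl | ht
        · rw [g0, ← f0] at h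
          rw [hfi hs (by norm_num) h]
        · exact absurd h (hfg s hs t ht)
      rintro ⟨s, t⟩ (⟨hs, rfl⟩ | ⟨rfl, ht⟩) ⟨s', t'⟩ (⟨hs', rfl⟩ | ⟨rfl, ht'⟩) h
      · rw [G1, G1] at h
        exact congrArg (·, (0 : ℝ)) (hfi hs hs' h)
      · rw [G1, G2] at h
        exact cross _ hs _ ht' h
      · rw [G1, G2] at h
        exact (cross _ hs' _ ht h.symm).symm
      · rw [G2, G2] at h
        exact congrArg ((0 : ℝ), ·) (hgi ht ht' h)
    have hemb := cG.domRestrict.isClosedEmbedding (injOn_iff_injective.1 iG)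
    refine ⟨_, hemb.isEmbedding.toHomeomorph, ⟨(0, 0), .inl ⟨by norm_num, rfl⟩⟩, rfl, ?_⟩
    exact (G1 0).trans f0

theorem IsRamificationPoint.notMem_endPoints {X : Type*} [TopologicalSpace X] [T2Space X] {x : X}
    (hx : IsRamificationPoint x) : x ∉ endPoints X := by
  obtain ⟨f, g, hf, hfi, -, -, rfl, -⟩ := isRamificationPoint_iff.1 hx
  exact not_mem_endPoints_of_interior hf hfi ⟨by norm_num, by norm_num⟩

/-- The line contains no simple triod: an injective `f` is strictly monotone, so it covers a
neighbourhood of `f 0 = g 0`, which `g` cannot leave at once. -/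
theorem exists_eq_of_injOn_of_continuousOn {f g : ℝ → ℝ} {ε : ℝ} (hε : 0 < ε)
    (hf : ContinuousOn f (Icc (-ε) ε)) (hfi : InjOn f (Icc (-ε) ε))
    (hg : ContinuousOn g (Icc 0 ε)) (h0 : f 0 = g 0) :
    ∃ s ∈ Icc (-ε) ε, ∃ t ∈ Ioc 0 ε, f s = g t := by
  wlog hmono : StrictMonoOn f (Icc (-ε) ε) generalizing f g
  · have hanti : StrictAntiOn f (Icc (-ε) ε) :=
      (hf.strictMonoOn_of_injOn_Icc' (by linarith) hfi).resolve_left hmono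
    obtain ⟨s, hs, t, ht, h⟩ := this (f := -f) (g := -g) hf.neg
      (neg_injective.comp_injOn hfi) hg.neg (by simp [h0]) hanti.neg
    exact ⟨s, hs, t, ht, neg_injective h⟩
  have z : (0 : ℝ) ∈ Icc (-ε) ε := ⟨by linarith, hε.le⟩
  have hmem : g 0 ∈ Ioo (f (-ε)) (f ε) := by
    rw [← h0]
    exact ⟨hmono ⟨le_rfl, by linarith⟩ z (by linarith), hmono z ⟨by linarith, le_rfl⟩ hε⟩
  have hev : ∀ᶠ t in 𝓝[>] (0 : ℝ), g t ∈ Ioo (f (-ε)) (f ε) := by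
    have h1 : ContinuousWithinAt g (Ioc 0 ε) 0 :=
      (hg 0 ⟨le_rfl, hε.le⟩).mono Ioc_subset_Icc_self
    have h2 := h1.eventually (isOpen_Ioo.mem_nhds hmem)
    rwa [nhdsWithin_Ioc_eq_nhdsGT hε] at h2
  obtain ⟨t, ht, ht'⟩ := (hev.and (Ioc_mem_nhdsGT hε)).exists
  obtain ⟨s, hs, h⟩ := intermediate_value_Icc (by linarith) hf (Ioo_subset_Icc_self ht)
  exact ⟨s, hs, t, ht', h⟩

theorem eq_of_isPreconnected_of_continuousOn {X C : Type*} [TopologicalSpace X]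
    [TopologicalSpace C] [TotallyDisconnectedSpace C] {O S : Set X} {π : X → C}
    (hπ : ContinuousOn π O) (hS : IsPreconnected S) (hSO : S ⊆ O) {x y : X} (hx : x ∈ S)
    (hy : y ∈ S) : π x = π y :=
  (hS.image π (hπ.mono hSO)).subsingleton ⟨x, hx, rfl⟩ ⟨y, hy, rfl⟩

/-- A small part of the triod around its top stays in `O`. Being connected it lies in one fibre of
`π`, and `u` would carry it injectively into the line. -/
theorem IsRamificationPoint.notMem_of_fibers {X C : Type*} [TopologicalSpace X] [T2Space X]
    [TopologicalSpace C] [TotallyDisconnectedSpace C] {O : Set X} (hO : IsOpen O) {π : X → C}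
    (hπ : ContinuousOn π O)
    (hfib : ∀ z ∈ O, ∃ u : X → ℝ, ContinuousOn u (O ∩ π ⁻¹' {π z}) ∧ InjOn u (O ∩ π ⁻¹' {π z}))
    {x : X} (hx : IsRamificationPoint x) : x ∉ O := by
  intro hxO
  obtain ⟨f, g, hf, hfi, hg, hgi, f0, g0, hfg⟩ := isRamificationPoint_iff.1 hx
  have ef : ∀ᶠ s in 𝓝 (0 : ℝ), f s ∈ O := (hf.continuousAt
    (Icc_mem_nhds (by norm_num) (by norm_num))).eventually (hO.mem_nhds (f0 ▸ hxO))
  have eg : ∀ᶠ s in 𝓝[Icc 0 1] (0 : ℝ), g s ∈ O :=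
    (hg 0 (by norm_num)).eventually (hO.mem_nhds (g0 ▸ hxO))
  rw [eventually_nhdsWithin_iff] at eg
  obtain ⟨δ, hδ, h⟩ := Metric.eventually_nhds_iff.1 (ef.and eg)
  set ε := min 1 (δ / 2) with hε
  have ε0 : 0 < ε := by positivity
  have ε1 : ε ≤ 1 := min_le_left _ _
  have εδ : ε < δ := (min_le_right _ _).trans_lt (by linarith)
  have hfO : MapsTo f (Icc (-ε) ε) O := fun s hs => (h (by
    rw [Real.dist_eq, sub_zero, abs_lt]; constructor <;> linarith [hs.1, hs.2])).1
  have hgO : MapsTo g (Icc 0 ε) O := fun s hs => (h (by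
    rw [Real.dist_eq, sub_zero, abs_lt]; constructor <;> linarith [hs.1, hs.2])).2
      ⟨hs.1, hs.2.trans ε1⟩
  have sf : Icc (-ε) ε ⊆ Icc (-1) 1 := Icc_subset_Icc (by linarith) ε1
  have sg : Icc 0 ε ⊆ Icc 0 1 := Icc_subset_Icc le_rfl ε1
  have hf' : MapsTo f (Icc (-ε) ε) (O ∩ π ⁻¹' {π x}) := fun s hs => ⟨hfO hs,
    eq_of_isPreconnected_of_continuousOn hπ (isPreconnected_Icc.image f (hf.mono sf))
      (image_subset_iff.2 hfO) ⟨s, hs, rfl⟩ ⟨0, ⟨by linarith, ε0.le⟩, f0⟩⟩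
  have hg' : MapsTo g (Icc 0 ε) (O ∩ π ⁻¹' {π x}) := fun s hs => ⟨hgO hs,
    eq_of_isPreconnected_of_continuousOn hπ (isPreconnected_Icc.image g (hg.mono sg))
      (image_subset_iff.2 hgO) ⟨s, hs, rfl⟩ ⟨0, ⟨le_rfl, ε0.le⟩, g0⟩⟩
  obtain ⟨u, hu, hui⟩ := hfib x hxO
  obtain ⟨s, hs, t, ht, hst⟩ := exists_eq_of_injOn_of_continuousOn ε0
    (hu.comp (hf.mono sf) hf') (hui.comp (hfi.mono sf) hf') (hu.comp (hg.mono sg) hg')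
    (by simp [f0, g0])
  exact hfg s (sf hs) t ⟨ht.1, ht.2.trans ε1⟩
    (hui (hf' hs) (hg' (Ioc_subset_Icc_self ht)) hst)

/-! ### Spaces that are unions of legs indexed by a totally disconnected space -/

/-- `X \ {o}` maps continuously to `C`, and every fibre together with `o` is an arc that has `o`
as an end-point. -/
structure IsLegSystem {X C : Type*} [TopologicalSpace X] [TopologicalSpace C] (o : X)
    (π : X → C) : Prop where
  continuousOn : ContinuousOn π {o}ᶜ
  exists_leg : ∀ z ≠ o, ∃ γ : unitInterval → X, Continuous γ ∧ γ.Injective ∧ γ 0 = o ∧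
    range γ = {w | w = o ∨ π w = π z}

namespace IsLegSystem

theorem ne_of_legs {X C : Type*} {o : X} {π : X → C} {z z' : X} {γ γ' : ℝ → X} (h0' : γ' 0 = o) (hzz : π z ≠ π z')
    (hi' : InjOn γ' (Icc 0 1)) (hr : γ '' Icc 0 1 = {w | w = o ∨ π w = π z})
    (hr' : γ' '' Icc 0 1 = {w | w = o ∨ π w = π z'}) :
    ∀ s ∈ Ioc (0 : ℝ) 1, ∀ t ∈ Icc (0 : ℝ) 1, γ' s ≠ γ t := by
  intro s hs t ht hst
  have ho : γ' s ≠ o := fun e =>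
    hs.1.ne' (hi' (Ioc_subset_Icc_self hs) ⟨le_rfl, zero_le_one⟩ (e.trans h0'.symm))
  have h1 : γ' s ∈ γ' '' Icc 0 1 := ⟨s, Ioc_subset_Icc_self hs, rfl⟩
  have h2 : γ t ∈ γ '' Icc 0 1 := ⟨t, ht, rfl⟩
  rw [hr'] at h1
  rw [hr, ← hst] at h2
  exact hzz ((h2.resolve_left ho).symm.trans (h1.resolve_left ho))

variable {X C : Type*} [TopologicalSpace X] [TopologicalSpace C] {o : X} {π : X → C}

theorem exists_real_leg (h : IsLegSystem o π) {z : X} (hz : z ≠ o) :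
    ∃ γ : ℝ → X, Continuous γ ∧ InjOn γ (Icc 0 1) ∧ γ 0 = o ∧
      γ '' Icc 0 1 = {w | w = o ∨ π w = π z} := by
  obtain ⟨γ, hγ, hi, h0, hr⟩ := h.exists_leg z hz
  refine ⟨IccExtend zero_le_one γ, hγ.Icc_extend', ?_, ?_, ?_⟩
  · intro s hs t ht hst
    rw [IccExtend_of_mem _ _ hs, IccExtend_of_mem _ _ ht] at hst
    exact congrArg Subtype.val (hi hst)
  · rw [IccExtend_of_mem _ _ ⟨le_rfl, zero_le_one⟩]
    exact h0
  · rw [← hr]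
    ext w
    constructor
    · rintro ⟨t, ht, rfl⟩
      rw [IccExtend_of_mem _ _ ht]
      exact ⟨_, rfl⟩
    · rintro ⟨t, rfl⟩
      exact ⟨t, t.2, IccExtend_of_mem _ _ t.2⟩

/-- Suppose `Y` skips `t₂` between `t₁` and `t₃`. Disjoint open sets `U`, `W` contain the parts of
`Y` on the leg above and below `t₂`. The rest of `Y` is compact and avoids `o` and the fibre of `z`,
so a clopen neighbourhood `N` of `π z` misses its image. The points of `Y` in `U` over `N` are then
split off from the others. -/
theorem ordConnected [T2Space X] [T2Space C] [CompactSpace C] [TotallyDisconnectedSpace C]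
    (h : IsLegSystem o π) {z : X} {γ : unitInterval → X} (hγ : Continuous γ) (hi : γ.Injective)
    (h0 : γ 0 = o) (hr : range γ = {w | w = o ∨ π w = π z}) {Y : Set X} (hY : IsCompact Y)
    (hY' : IsPreconnected Y) : (γ ⁻¹' Y).OrdConnected := by
  refine ⟨fun t₁ h₁ t₃ h₃ t₂ h₂ => ?_⟩
  by_contra hn
  have comp : ∀ I : Set unitInterval, IsClosed I → IsCompact (Y ∩ γ '' I) := fun I hI =>
    hY.inter (hI.isCompact.image hγ)
  have disj : Disjoint (Y ∩ γ '' Icc t₂ 1) (Y ∩ γ '' Icc 0 t₂) := by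
    rw [Set.disjoint_left]
    rintro _ ⟨hY, s, hs, rfl⟩ ⟨-, t, ht, hst⟩
    have := hi hst
    subst this
    exact hn (le_antisymm hs.1 ht.2 ▸ hY)
  obtain ⟨U, W, hU, hW, hKU, hKW, hUW⟩ :=
    SeparatedNhds.of_isCompact_isCompact (comp _ isClosed_Icc) (comp _ isClosed_Icc) disj
  have oW : o ∈ Y → o ∈ W := fun ho =>
    hKW ⟨ho, 0, ⟨le_rfl, unitInterval.nonneg t₂⟩, h0⟩
  have oD : ∀ w ∈ Y \ (U ∪ W), w ≠ o := by
    rintro w ⟨hw, hn⟩ rfl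
    exact hn (.inr (oW hw))
  have hD : IsClosed (π '' (Y \ (U ∪ W))) :=
    ((hY.diff (hU.union hW)).image_of_continuousOn (h.continuousOn.mono oD)).isClosed
  have cD : π z ∉ π '' (Y \ (U ∪ W)) := by
    rintro ⟨w, ⟨hw, hn⟩, hwz⟩
    obtain ⟨t, rfl⟩ : w ∈ range γ := by rw [hr]; exact .inr hwz
    rcases le_total t₂ t with ht | ht
    · exact hn (.inl (hKU ⟨hw, t, ⟨ht, unitInterval.le_one t⟩, rfl⟩))
    · exact hn (.inr (hKW ⟨hw, t, ⟨unitInterval.nonneg t, ht⟩, rfl⟩))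
  obtain ⟨N, hN, hzN, hND⟩ := compact_exists_isClopen_in_isOpen hD.isOpen_compl cD
  have open₁ : IsOpen ({o}ᶜ ∩ π ⁻¹' N) :=
    h.continuousOn.isOpen_inter_preimage isOpen_compl_singleton hN.isOpen
  have open₂ : IsOpen ({o}ᶜ ∩ π ⁻¹' Nᶜ) :=
    h.continuousOn.isOpen_inter_preimage isOpen_compl_singleton hN.compl.isOpen
  have t₂₃ : t₂ < t₃ := h₂.2.lt_of_ne fun e => hn (e ▸ h₃)
  have γ₃ : γ t₃ ≠ o := fun e =>
    ((unitInterval.nonneg t₂).trans_lt t₂₃).ne' (congrArg Subtype.val (hi (e.trans h0.symm)))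
  have π₃ : π (γ t₃) = π z := by
    have : γ t₃ ∈ range γ := ⟨_, rfl⟩
    rw [hr] at this
    exact this.resolve_left γ₃
  have cover : Y ⊆ (({o}ᶜ ∩ π ⁻¹' N) ∩ U) ∪ (({o}ᶜ ∩ π ⁻¹' Nᶜ) ∪ W) := by
    intro w hw
    by_cases hwW : w ∈ W
    · exact .inr (.inr hwW)
    have hwo : w ≠ o := fun e => hwW (e ▸ oW (e ▸ hw))
    by_cases hwN : π w ∈ N
    · refine .inl ⟨⟨hwo, hwN⟩, ?_⟩
      by_contra hwU
      exact hND hwN ⟨w, ⟨hw, fun h => h.elim hwU hwW⟩, rfl⟩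
    · exact .inr (.inl ⟨hwo, hwN⟩)
  obtain ⟨w, hwY, ⟨⟨hwo, hwN⟩, hwU⟩, hw⟩ := hY' (({o}ᶜ ∩ π ⁻¹' N) ∩ U) (({o}ᶜ ∩ π ⁻¹' Nᶜ) ∪ W)
    (open₁.inter hU) (open₂.union hW) cover
    ⟨γ t₃, h₃, ⟨γ₃, by rw [mem_preimage, π₃]; exact hzN⟩,
      hKU ⟨h₃, t₃, ⟨t₂₃.le, unitInterval.le_one t₃⟩, rfl⟩⟩
    ⟨γ t₁, h₁, .inr (hKW ⟨h₁, t₁, ⟨unitInterval.nonneg t₁, h₂.1⟩, rfl⟩)⟩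
  rcases hw with hw | hw
  · exact hw.2 hwN
  · exact hUW.le_bot ⟨hwU, hw⟩

/-- A continuum avoiding `o` lies in one leg, where the intersection is one of two intervals. If
both continua contain `o`, each common point is joined to `o` along its leg inside both. -/
theorem isHereditarilyUnicoherent [TopologicalSpace.MetrizableSpace X] [T2Space C] [CompactSpace C]
    [TotallyDisconnectedSpace C] (h : IsLegSystem o π) : IsHereditarilyUnicoherent X := by
  rw [isHereditarilyUnicoherent_iff]
  have one_leg : ∀ A B : Set X, IsCompact A → IsConnected A → IsCompact B →
      IsConnected B → (A ∩ B).Nonempty → o ∉ A → IsConnected (A ∩ B) := by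
    intro A B hA hA' hB hB' hAB ho
    refine ⟨hAB, ?_⟩
    obtain ⟨z, hzA, hzB⟩ := hAB
    obtain ⟨γ, hγ, hi, h0, hr⟩ := h.exists_leg z fun e => ho (e ▸ hzA)
    have hAγ : A ⊆ range γ := fun w hw => by
      rw [hr]
      exact .inr (eq_of_isPreconnected_of_continuousOn h.continuousOn hA'.2
        (fun v hv e => ho (e ▸ hv)) hw hzA)
    have hAB : A ∩ B = γ '' (γ ⁻¹' A ∩ γ ⁻¹' B) := by
      rw [← preimage_inter, image_preimage_eq_of_subset (inter_subset_left.trans hAγ)]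
    rw [hAB]
    have := (h.ordConnected hγ hi h0 hr hA hA'.2).inter (h.ordConnected hγ hi h0 hr hB hB'.2)
    exact this.isPreconnected.image γ hγ.continuousOn
  intro A B hA hA' hB hB' hAB
  by_cases hoA : o ∈ A
  swap
  · exact one_leg A B hA hA' hB hB' hAB hoA
  by_cases hoB : o ∈ B
  swap
  · rw [inter_comm] at hAB ⊢
    exact one_leg B A hB hB' hA hA' hAB hoB
  refine ⟨hAB, isPreconnected_of_forall o fun z hz => ?_⟩
  by_cases hzo : z = o
  · subst hzo
    exact ⟨{z}, by simpa using hz, rfl, rfl, isPreconnected_singleton⟩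
  obtain ⟨γ, hγ, hi, h0, hr⟩ := h.exists_leg z hzo
  obtain ⟨t, rfl⟩ : z ∈ range γ := by rw [hr]; exact .inr rfl
  refine ⟨γ '' Icc 0 t, ?_, ⟨0, ⟨le_rfl, unitInterval.nonneg t⟩, h0⟩,
    ⟨t, ⟨unitInterval.nonneg t, le_rfl⟩, rfl⟩, isPreconnected_Icc.image γ hγ.continuousOn⟩
  rw [← h0] at hoA hoB
  rw [image_subset_iff]
  exact fun s hs => ⟨(h.ordConnected hγ hi h0 hr hA hA'.2).out hoA hz.1 hs,
    (h.ordConnected hγ hi h0 hr hB hB'.2).out hoB hz.2 hs⟩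

/-- Two different legs form a single arc. -/
theorem continuousOn_injOn_union {γ γ' : ℝ → X} (hγ : Continuous γ) (hγ' : Continuous γ')
    (hi : InjOn γ (Icc 0 1)) (hi' : InjOn γ' (Icc 0 1)) (h0 : γ 0 = γ' 0)
    (hd : ∀ s ∈ Ioc (0 : ℝ) 1, ∀ t ∈ Icc (0 : ℝ) 1, γ' s ≠ γ t) :
    Continuous (fun s => if 0 ≤ s then γ s else γ' (-s)) ∧
      InjOn (fun s => if 0 ≤ s then γ s else γ' (-s)) (Icc (-1) 1) := by
  constructor
  · refine Continuous.if_le hγ (hγ'.comp continuous_neg) continuous_const continuous_id ?_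
    intro s hs
    simp [← hs, h0]
  · intro s hs t ht hst
    dsimp only at hst
    split_ifs at hst with h1 h2 h2
    · exact hi ⟨h1, hs.2⟩ ⟨h2, ht.2⟩ hst
    · exact absurd hst.symm (hd _ ⟨by linarith, by linarith [ht.1]⟩ _ ⟨h1, hs.2⟩)
    · exact absurd hst (hd _ ⟨by linarith, by linarith [hs.1]⟩ _ ⟨h2, ht.2⟩)
    · exact neg_injective (hi' ⟨by linarith, by linarith [hs.1]⟩
        ⟨by linarith, by linarith [ht.1]⟩ hst)

theorem exists_isArcBetween [T2Space X] (h : IsLegSystem o π) (x y : X) :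
    ∃ S : Set X, IsArcBetween S x y := by
  by_cases hx : x = o
  · by_cases hy : y = o
    · exact ⟨{x}, .inl ⟨hx.trans hy.symm, rfl⟩⟩
    · obtain ⟨γ, hγ, hi, h0, hr⟩ := h.exists_real_leg hy
      obtain ⟨t, ht, rfl⟩ : y ∈ γ '' Icc 0 1 := by rw [hr]; exact .inr rfl
      rw [hx, ← h0]
      exact ⟨_, isArcBetween_image ht.1 hγ.continuousOn (hi.mono (Icc_subset_Icc le_rfl ht.2))⟩
  obtain ⟨γ, hγ, hi, h0, hr⟩ := h.exists_real_leg hx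
  obtain ⟨s, hs, hsx⟩ : x ∈ γ '' Icc 0 1 := by rw [hr]; exact .inr rfl
  by_cases hy : y = o ∨ π y = π x
  · obtain ⟨t, ht, hty⟩ : y ∈ γ '' Icc 0 1 := by rw [hr]; exact hy
    rw [← hsx, ← hty]
    rcases le_total s t with hst | hst
    · exact ⟨_, isArcBetween_image hst hγ.continuousOn (hi.mono (Icc_subset_Icc hs.1 ht.2))⟩
    · exact ⟨_, (isArcBetween_image hst hγ.continuousOn
        (hi.mono (Icc_subset_Icc ht.1 hs.2))).symm⟩
  · push Not at hy
    obtain ⟨γ', hγ', hi', h0', hr'⟩ := h.exists_real_leg hy.1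
    obtain ⟨t, ht, hty⟩ : y ∈ γ' '' Icc 0 1 := by rw [hr']; exact .inr rfl
    obtain ⟨hc, hinj⟩ := continuousOn_injOn_union hγ hγ' hi hi' (h0.trans h0'.symm)
      (ne_of_legs h0' hy.2.symm hi' hr hr')
    have := isArcBetween_image (p := -t) (q := s) (by linarith [ht.1, hs.1]) hc.continuousOn
      (hinj.mono (Icc_subset_Icc (by linarith [ht.2]) hs.2))
    have ht0 : 0 < t := ht.1.lt_of_ne (by
      rintro rfl
      exact hy.1 (hty.symm.trans h0'))
    simp only [hs.1, if_true, neg_neg, hsx, hty, not_le.2 (neg_lt_zero.2 ht0), if_false] at this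
    exact ⟨_, this.symm⟩

theorem eq_of_isRamificationPoint [T2Space X] [CompactSpace X] [TotallyDisconnectedSpace C]
    (h : IsLegSystem o π) {x : X} (hx : IsRamificationPoint x) : x = o := by
  by_contra hxo
  refine hx.notMem_of_fibers isOpen_compl_singleton h.continuousOn (fun z hz => ?_) hxo
  obtain ⟨γ, hγ, hi, h0, hr⟩ := h.exists_leg z hz
  -- Tietze: the inverse of the embedding `γ` extends from its closed range to a function that is
  -- injective on the fibre.
  obtain ⟨u, hu⟩ := ContinuousMap.exists_extension' (hγ.isClosedEmbedding hi)
    (⟨fun t => (t : ℝ), continuous_subtype_val⟩ : C(unitInterval, ℝ))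
  refine ⟨u, u.continuous.continuousOn, ?_⟩
  have hsub : ∀ w ∈ {o}ᶜ ∩ π ⁻¹' {π z}, w ∈ range γ := fun w hw => by
    rw [hr]
    exact .inr hw.2
  intro v hv w hw hvw
  obtain ⟨s, rfl⟩ := hsub v hv
  obtain ⟨t, rfl⟩ := hsub w hw
  have := congrFun hu
  simp only [Function.comp_apply, ContinuousMap.coe_mk] at this
  rw [this, this] at hvw
  rw [Subtype.ext hvw]

theorem isFan [TopologicalSpace.MetrizableSpace X] [CompactSpace X] [T2Space C] [CompactSpace C]
    [TotallyDisconnectedSpace C] (h : IsLegSystem o π) : IsFan X := by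
  refine ⟨⟨⟨inferInstance, inferInstance, ?_⟩, h.exists_isArcBetween,
    h.isHereditarilyUnicoherent⟩, fun v w hv hw =>
      (h.eq_of_isRamificationPoint hv).trans (h.eq_of_isRamificationPoint hw).symm⟩
  have : Nonempty X := ⟨o⟩
  have : PreconnectedSpace X := ⟨isPreconnected_of_forall o fun z _ => by
    obtain ⟨S, hS⟩ := h.exists_isArcBetween o z
    exact ⟨S, subset_univ _, hS.left_mem, hS.symm.left_mem, hS.isConnected.2⟩⟩
  exact ⟨inferInstance⟩

/-- Two legs joined at `o` form the bar of a triod, and the third leg is its stem. -/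
theorem isRamificationPoint [T2Space X] (h : IsLegSystem o π) {x y z : X} (hx : x ≠ o)
    (hy : y ≠ o) (hz : z ≠ o) (hxy : π x ≠ π y) (hxz : π x ≠ π z) (hyz : π y ≠ π z) :
    IsRamificationPoint o := by
  obtain ⟨γ, hγ, hi, h0, hr⟩ := h.exists_real_leg hx
  obtain ⟨γ', hγ', hi', h0', hr'⟩ := h.exists_real_leg hy
  obtain ⟨g, hg, hig, hg0, hrg⟩ := h.exists_real_leg hz
  obtain ⟨hc, hinj⟩ := continuousOn_injOn_union hγ hγ' hi hi' (h0.trans h0'.symm)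
    (ne_of_legs h0' hxy hi' hr hr')
  refine isRamificationPoint_iff.2 ⟨_, g, hc.continuousOn, hinj, hg.continuousOn, hig,
    by simpa using h0, hg0, ?_⟩
  intro s hs t ht
  split_ifs with h1
  · exact (ne_of_legs hg0 hxz hig hr hrg t ht s ⟨h1, hs.2⟩).symm
  · exact (ne_of_legs hg0 hyz hig hr' hrg t ht (-s) ⟨by linarith, by linarith [hs.1]⟩).symm

end IsLegSystem

/-! ### Radial subsets of the Cantor fan -/

instance : CompactSpace cantorSet := isCompact_iff_compactSpace.1 isCompact_cantorSet

instance : TotallyDisconnectedSpace cantorSet :=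
  cantorSetHomeomorphNatToBool.symm.totallyDisconnectedSpace

theorem mem_cantorFan_iff {x : ℝ × ℝ} :
    x ∈ cantorFan ↔ x.2 ∈ Icc (0 : ℝ) 1 ∧ ∃ c ∈ cantorSet, x.1 = c * x.2 := by
  simp only [cantorFan, mem_iUnion, segment_eq_image, mem_image, exists_prop]
  constructor
  · rintro ⟨c, hc, t, ht, rfl⟩
    exact ⟨by simpa using ht, c, hc, by simp [mul_comm]⟩
  · rintro ⟨h, c, hc, hx⟩
    exact ⟨c, hc, x.2, h, Prod.ext (by simp [hx, mul_comm]) (by simp)⟩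

/-- At the origin `0 / 0 = 0` is in the Cantor set, so the slope is defined everywhere; it is
continuous only off the origin. -/
theorem fst_div_snd_mem_cantorSet {x : ℝ × ℝ} (hx : x ∈ cantorFan) : x.1 / x.2 ∈ cantorSet := by
  obtain ⟨-, c, hc, h⟩ := mem_cantorFan_iff.1 hx
  by_cases h2 : x.2 = 0
  · rw [h2, div_zero]
    exact zero_mem_cantorSet
  · rwa [h, mul_div_cancel_right₀ _ h2]

section
variable {X : Set (ℝ × ℝ)} (hX : X ⊆ cantorFan)

/-- The parameter in the Cantor set of the leg of the Cantor fan that contains `x`. -/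
noncomputable def slope (x : X) : cantorSet :=
  ⟨(x : ℝ × ℝ).1 / (x : ℝ × ℝ).2, fst_div_snd_mem_cantorSet (hX x.2)⟩

include hX in
theorem snd_nonneg (x : X) : 0 ≤ (x : ℝ × ℝ).2 := (mem_cantorFan_iff.1 (hX x.2)).1.1

theorem fst_eq (x : X) : (x : ℝ × ℝ).1 = slope hX x * (x : ℝ × ℝ).2 := by
  obtain ⟨-, c, -, h⟩ := mem_cantorFan_iff.1 (hX x.2)
  by_cases h2 : (x : ℝ × ℝ).2 = 0
  · simp [h, h2]
  · simp [slope, h2]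

include hX in
theorem snd_pos {x : X} (hx : (x : ℝ × ℝ) ≠ 0) : 0 < (x : ℝ × ℝ).2 := by
  refine (snd_nonneg hX x).lt_of_ne' fun h => hx (Prod.ext ?_ h)
  rw [fst_eq hX, h, mul_zero]; rfl

theorem eq_smul_of_slope_eq {x y : X} (hy : (y : ℝ × ℝ) ≠ 0) (h : slope hX x = slope hX y) :
    (x : ℝ × ℝ) = ((x : ℝ × ℝ).2 / (y : ℝ × ℝ).2) • (y : ℝ × ℝ) := by
  have := (snd_pos hX hy).ne'
  refine Prod.ext ?_ ?_
  · simp only [Prod.smul_fst, smul_eq_mul]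
    rw [fst_eq hX y, fst_eq hX x, h]
    field_simp
  · simp [this]

theorem slope_eq_of_eq_smul {x y : X} {t : ℝ} (hx : (x : ℝ × ℝ) ≠ 0)
    (h : (x : ℝ × ℝ) = t • (y : ℝ × ℝ)) : slope hX x = slope hX y := by
  have ht : t ≠ 0 := by
    rintro rfl
    exact hx (by simpa using h)
  refine Subtype.ext ?_
  simp only [slope]
  rw [h, Prod.smul_fst, Prod.smul_snd, smul_eq_mul, smul_eq_mul, mul_div_mul_left _ _ ht]

theorem eq_of_slope_eq {x y : X} (h : slope hX x = slope hX y)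
    (h2 : (x : ℝ × ℝ).2 = (y : ℝ × ℝ).2) : x = y := by
  refine Subtype.ext (Prod.ext ?_ h2)
  rw [fst_eq hX x, fst_eq hX y, h, h2]

theorem continuousOn_slope : ContinuousOn (slope hX) {x | (x : ℝ × ℝ) ≠ 0} := by
  have h : ContinuousOn (fun x : X => (x : ℝ × ℝ).1 / (x : ℝ × ℝ).2) {x | (x : ℝ × ℝ) ≠ 0} :=
    ContinuousOn.div (by fun_prop) (by fun_prop) fun x hx => (snd_pos hX hx).ne'
  exact IsInducing.subtypeVal.continuousOn_iff.2 h

theorem isOpen_ne_zero : IsOpen {x : X | (x : ℝ × ℝ) ≠ 0} :=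
  isOpen_ne_fun continuous_subtype_val continuous_const

include hX in
theorem IsRamificationPoint.coe_eq_zero {v : X} (hv : IsRamificationPoint v) :
    (v : ℝ × ℝ) = 0 := by
  by_contra h
  refine hv.notMem_of_fibers isOpen_ne_zero (continuousOn_slope hX) (fun z _ => ?_) h
  refine ⟨fun x => (x : ℝ × ℝ).2, by fun_prop, ?_⟩
  rintro x ⟨-, hx⟩ y ⟨-, hy⟩ hxy
  exact eq_of_slope_eq hX (hx.trans hy.symm) hxy

end

/-- `X` is a subset of the Cantor fan that is star-shaped with respect to the origin. -/
structure IsRadial (X : Set (ℝ × ℝ)) : Prop where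
  subset : X ⊆ cantorFan
  zero_mem : (0 : ℝ × ℝ) ∈ X
  smul_mem : ∀ x ∈ X, ∀ t ∈ Icc (0 : ℝ) 1, t • x ∈ X

/-- The segment from the origin to `x`, as a subset of `X`. -/
def ray {X : Set (ℝ × ℝ)} (x : X) : Set X :=
  {y | ∃ t ∈ Icc (0 : ℝ) 1, (y : ℝ × ℝ) = t • (x : ℝ × ℝ)}

/-- The arc in `X` from the origin to `x` has constant slope after time `0`. By the intermediate
value theorem it attains the height `t * x.2`, and the point there is `t • x`. -/
theorem isRadial_of_isDendroid {X : Set (ℝ × ℝ)} (hX : X ⊆ cantorFan) (hd : IsDendroid X)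
    (h0 : (0 : ℝ × ℝ) ∈ X) : IsRadial X := by
  refine ⟨hX, h0, fun x hx t ht => ?_⟩
  rcases ht.1.eq_or_lt with rfl | ht0
  · rwa [zero_smul]
  obtain ⟨S, ⟨h, -⟩ | ⟨h, hs0, hs1⟩⟩ := hd.2.1 ⟨0, h0⟩ ⟨x, hx⟩
  · have : x = 0 := (congrArg Subtype.val h).symm
    rwa [this, smul_zero, ← this]
  set p : unitInterval → X := fun s => h s with hp
  have cp : Continuous p := by fun_prop
  by_cases hx0 : x = 0
  · rwa [hx0, smul_zero]
  have hx2 : 0 < x.2 := snd_pos hX (x := ⟨x, hx⟩) hx0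
  obtain ⟨s, hs⟩ : t * x.2 ∈ range fun s => ((p s : X) : ℝ × ℝ).2 := by
    refine mem_range_of_exists_le_of_exists_ge (by fun_prop) ⟨0, ?_⟩ ⟨1, ?_⟩
    · simp only [hp, hs0]
      exact mul_nonneg ht.1 hx2.le
    · simp only [hp, hs1]
      exact mul_le_of_le_one_left hx2.le ht.2
  have p0 : ∀ s ∈ Ioc (0 : unitInterval) 1, ((p s : X) : ℝ × ℝ) ≠ 0 := by
    intro s hs e
    have : p s = p 0 := by simp only [hp, hs0]; exact Subtype.ext e
    exact hs.1.ne' (h.injective (Subtype.ext this))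
  have hs' : s ∈ Ioc (0 : unitInterval) 1 := by
    refine ⟨?_, unitInterval.le_one s⟩
    rw [unitInterval.pos_iff_ne_zero]
    rintro rfl
    simp only [hp, hs0] at hs
    exact (mul_pos ht0 hx2).ne hs
  have hsl : slope hX (p s) = slope hX (p 1) :=
    eq_of_isPreconnected_of_continuousOn (continuousOn_slope hX)
      (isPreconnected_Ioc.image p cp.continuousOn) (by rintro _ ⟨s, hs, rfl⟩; exact p0 s hs)
      ⟨s, hs', rfl⟩ ⟨1, ⟨zero_lt_one, le_rfl⟩, rfl⟩
  have hp1 : p 1 = ⟨x, hx⟩ := hs1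
  have := eq_smul_of_slope_eq hX (p0 1 ⟨zero_lt_one, le_rfl⟩) hsl
  rw [hp1] at this
  dsimp only at hs this
  rw [hs, mul_div_cancel_right₀ _ hx2.ne'] at this
  rw [← this]
  exact (p s).2

namespace IsRadial

variable {X : Set (ℝ × ℝ)} (hX : IsRadial X)

/-- The origin as a point of `X`. -/
def origin : X := ⟨0, hX.zero_mem⟩

/-- The linear path from the origin to `x`. -/
def path (x : X) (t : unitInterval) : X := ⟨(t : ℝ) • (x : ℝ × ℝ), hX.smul_mem x x.2 t t.2⟩

theorem continuous_path (x : X) : Continuous (hX.path x) := by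
  unfold path
  fun_prop

theorem range_path (x : X) : range (hX.path x) = ray x := by
  ext y
  constructor
  · rintro ⟨t, rfl⟩
    exact ⟨t, t.2, rfl⟩
  · rintro ⟨t, ht, h⟩
    exact ⟨⟨t, ht⟩, Subtype.ext h.symm⟩

theorem path_zero (x : X) : hX.path x 0 = hX.origin := Subtype.ext (by simp [path, origin])

theorem path_one (x : X) : hX.path x 1 = x := Subtype.ext (by simp [path])

theorem path_injective {x : X} (hx : (x : ℝ × ℝ) ≠ 0) : (hX.path x).Injective := fun _ _ h =>
  Subtype.ext (smul_left_injective ℝ hx (congrArg Subtype.val h))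

theorem isArcBetween_ray (x : X) : IsArcBetween (ray x) hX.origin x := by
  by_cases hx : (x : ℝ × ℝ) = 0
  · refine .inl ⟨Subtype.ext hx.symm, ?_⟩
    ext y
    simp only [ray, hx, smul_zero, mem_ofPred_eq, mem_singleton_iff]
    refine ⟨fun ⟨t, _, h⟩ => Subtype.ext h, fun h => ⟨0, by norm_num, ?_⟩⟩
    rw [h]; rfl
  · have := isArcBetween_range (hX.continuous_path x) (hX.path_injective hx)
    rwa [range_path, path_zero, path_one] at this

theorem mem_ray_self (x : X) : x ∈ ray x := ⟨1, by norm_num, by simp⟩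

theorem exists_isMax (hc : IsCompact X) {x : X} (hx : (x : ℝ × ℝ) ≠ 0) :
    ∃ e : X, (e : ℝ × ℝ) ≠ 0 ∧ slope hX.subset e = slope hX.subset x ∧
      ∀ y : X, slope hX.subset y = slope hX.subset e → y ∈ ray e := by
  have : CompactSpace X := isCompact_iff_compactSpace.1 hc
  have hx2 := snd_pos hX.subset hx
  -- The linear equation, unlike equality of slopes, describes a closed set: it also includes the
  -- origin.
  have hK : IsCompact {y : X | (y : ℝ × ℝ).1 = slope hX.subset x * (y : ℝ × ℝ).2} :=
    (isClosed_eq (by fun_prop) (by fun_prop)).isCompact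
  obtain ⟨e, he, hmax⟩ := hK.exists_isMaxOn ⟨x, fst_eq hX.subset x⟩
    (f := fun y => (y : ℝ × ℝ).2) (by fun_prop)
  have he2 : 0 < (e : ℝ × ℝ).2 := hx2.trans_le (hmax (fst_eq hX.subset x))
  have he0 : (e : ℝ × ℝ) ≠ 0 := fun h => he2.ne' (by simp [h])
  have hsl : slope hX.subset e = slope hX.subset x := by
    refine Subtype.ext (mul_right_cancel₀ he2.ne' ?_)
    rw [← fst_eq]
    exact he
  refine ⟨e, he0, hsl, fun y hy => ⟨_, ⟨?_, ?_⟩, eq_smul_of_slope_eq hX.subset he0 hy⟩⟩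
  · exact div_nonneg (snd_nonneg hX.subset y) he2.le
  · rw [div_le_one he2]
    refine hmax ?_
    show (y : ℝ × ℝ).1 = _
    rw [fst_eq hX.subset y, hy, hsl]

/-- If `e` were interior to an arc, the slope would be constant on the arc near `e`, so the height
would be strictly monotone there and exceed that of `e` on one side. -/
theorem mem_endPoints_of_isMax {e : X} (he : (e : ℝ × ℝ) ≠ 0)
    (hmax : ∀ y : X, slope hX.subset y = slope hX.subset e → y ∈ ray e) : e ∈ endPoints X := by
  rintro S ⟨h⟩ heS
  set s := h.symm ⟨e, heS⟩ with hs
  have hse : (h s : X) = e := by simp [hs]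
  rcases (unitInterval.nonneg s).eq_or_lt with h0 | h0
  · exact ⟨h, by rw [← hse]; congr; exact Subtype.ext h0⟩
  rcases (unitInterval.le_one s).eq_or_lt with h1 | h1
  · refine ⟨unitInterval.symmHomeomorph.trans h, ?_⟩
    rw [← hse]
    simp only [Homeomorph.trans_apply, unitInterval.symmHomeomorph_apply, unitInterval.symm_zero]
    congr
    exact Subtype.ext h1.symm
  exfalso
  set p : ℝ → X := fun t => h (projIcc 0 1 zero_le_one t) with hp
  have cp : Continuous p := by
    have := continuous_projIcc (a := (0 : ℝ)) (b := 1) (h := zero_le_one)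
    fun_prop
  have ip : InjOn p (Icc 0 1) := fun t ht r hr htr => by
    have := h.injective (Subtype.ext htr)
    rw [projIcc_of_mem _ ht, projIcc_of_mem _ hr] at this
    exact congrArg Subtype.val this
  have ps : p s = e := by simp [hp, hse]
  have hev : ∀ᶠ t in 𝓝 (s : ℝ), t ∈ Icc (0 : ℝ) 1 ∧ (p t : ℝ × ℝ) ≠ 0 :=
    (Filter.Eventually.and (Icc_mem_nhds h0 h1)) (cp.continuousAt.eventually
      (isOpen_ne_zero.mem_nhds (by simpa [ps] using he)))
  obtain ⟨δ, hδ, hball⟩ := Metric.eventually_nhds_iff.1 hev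
  set ε := δ / 2 with hε
  have hI : ∀ t ∈ Icc (s - ε) (s + ε : ℝ), t ∈ Icc (0 : ℝ) 1 ∧ (p t : ℝ × ℝ) ≠ 0 := fun t ht =>
    hball (by rw [Real.dist_eq, abs_lt]; constructor <;> linarith [ht.1, ht.2])
  have hsI : (s : ℝ) ∈ Icc (s - ε) (s + ε : ℝ) := ⟨by linarith, by linarith⟩
  have hsl : ∀ t ∈ Icc (s - ε) (s + ε : ℝ), slope hX.subset (p t) = slope hX.subset e := fun t ht =>
    eq_of_isPreconnected_of_continuousOn (continuousOn_slope hX.subset)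
      (isPreconnected_Icc.image p cp.continuousOn)
      (by rintro _ ⟨r, hr, rfl⟩; exact (hI r hr).2) ⟨t, ht, rfl⟩ ⟨s, hsI, ps⟩
  have hle : ∀ t ∈ Icc (s - ε) (s + ε : ℝ), (p t : ℝ × ℝ).2 ≤ (p s : ℝ × ℝ).2 := by
    intro t ht
    obtain ⟨r, hr, h⟩ := hmax _ (hsl t ht)
    rw [h, ps, Prod.smul_snd, smul_eq_mul]
    exact mul_le_of_le_one_left (snd_nonneg hX.subset e) hr.2
  have hinj : InjOn (fun t => (p t : ℝ × ℝ).2) (Icc (s - ε) (s + ε : ℝ)) := fun t ht r hr htr =>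
    ip (hI t ht).1 (hI r hr).1
      (eq_of_slope_eq hX.subset ((hsl t ht).trans (hsl r hr).symm) htr)
  have l : (s : ℝ) - ε ∈ Icc (s - ε) (s + ε : ℝ) := ⟨le_rfl, by linarith⟩
  have r : (s : ℝ) + ε ∈ Icc (s - ε) (s + ε : ℝ) := ⟨by linarith, le_rfl⟩
  rcases ContinuousOn.strictMonoOn_of_injOn_Icc' (by linarith)
    (f := fun t => (p t : ℝ × ℝ).2) (by fun_prop) hinj with hm | hm
  · exact absurd (hm hsI r (by linarith)) (hle _ r).not_gt
  · exact absurd (hm l hsI (by linarith)) (hle _ l).not_gt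

theorem mem_ray_of_mem_endPoints {e : X} (he : e ∈ endPoints X) (he0 : (e : ℝ × ℝ) ≠ 0) {y : X}
    (hy : slope hX.subset y = slope hX.subset e) : y ∈ ray e := by
  have he2 := snd_pos hX.subset he0
  rcases le_or_gt (y : ℝ × ℝ).2 (e : ℝ × ℝ).2 with h | h
  · exact ⟨_, ⟨div_nonneg (snd_nonneg hX.subset y) he2.le, (div_le_one he2).2 h⟩,
      eq_smul_of_slope_eq hX.subset he0 hy⟩
  exfalso
  have hy2 := he2.trans h
  have hy0 : (y : ℝ × ℝ) ≠ 0 := fun h => hy2.ne' (by simp [h])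
  have hmem : (e : ℝ × ℝ).2 / (y : ℝ × ℝ).2 ∈ Ioo (0 : ℝ) 1 :=
    ⟨div_pos he2 hy2, (div_lt_one hy2).2 h⟩
  refine not_mem_endPoints_of_interior (f := IccExtend zero_le_one (hX.path y))
    (hX.continuous_path y).Icc_extend'.continuousOn ?_ hmem ?_
  · intro s hs t ht hst
    rw [IccExtend_of_mem _ _ hs, IccExtend_of_mem _ _ ht] at hst
    exact congrArg Subtype.val (hX.path_injective hy0 hst)
  · rw [IccExtend_of_mem _ _ (Ioo_subset_Icc_self hmem)]
    convert he
    exact Subtype.ext (eq_smul_of_slope_eq hX.subset hy0 hy.symm).symm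

end IsRadial

/-! ### Transitivity and fixed points -/

/-- The iterates of an open set of fixed points stay in place, so they never reach a disjoint open
set. -/
theorem IsTransitiveMap.subsingleton_of_fixed {X : Type*} [TopologicalSpace X] [T2Space X]
    {f : X → X} (hf : IsTransitiveMap f) {U : Set X} (hU : IsOpen U) (hfix : ∀ x ∈ U, f x = x) :
    U.Subsingleton := by
  intro x hx y hy
  by_contra hxy
  obtain ⟨V, W, hV, hW, hxV, hyW, hVW⟩ := t2_separation hxy
  obtain ⟨n, _, ⟨z, ⟨hzU, hzV⟩, rfl⟩, -, hzW⟩ :=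
    hf _ _ (hU.inter hV) (hU.inter hW) ⟨x, hx, hxV⟩ ⟨y, hy, hyW⟩
  rw [Function.iterate_fixed (hfix z hzU)] at hzW
  exact hVW.le_bot ⟨hzV, hzW⟩

theorem IsRadial.mem_closure_compl_ray {X : Set (ℝ × ℝ)} (hX : IsRadial X) {φ : X → X}
    (hφ : IsTransitiveMap φ) {a b : X} (ha : (a : ℝ × ℝ) ≠ 0) (hfix : ∀ x ∈ ray a, φ x = x)
    (hb : b ∈ ray a) : b ∈ closure (ray a)ᶜ := by
  by_contra hn
  rw [closure_compl, notMem_compl_iff] at hn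
  have hs := hφ.subsingleton_of_fixed isOpen_interior fun x hx => hfix x (interior_subset hx)
  rw [← hX.range_path] at hb
  obtain ⟨t, rfl⟩ := hb
  have hev : ∀ᶠ s in 𝓝[≠] t, hX.path a s ∈ interior (ray a) :=
    ((hX.continuous_path a).continuousAt.eventually (isOpen_interior.mem_nhds hn)).filter_mono
      nhdsWithin_le_nhds
  obtain ⟨s, hs', hst⟩ := (hev.and self_mem_nhdsWithin).exists
  exact hst (hX.path_injective ha (hs hs' hn))

/-! ### Hausdorff limits -/

/-- The limit parametrisation need not be injective after applying `q`, so it may backtrack; this is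
what happens on the folded leg. -/
theorem hausdorffTendsto_range_comp {X Y ι : Type*} [PseudoMetricSpace X] [CompactSpace X]
    [t : TopologicalSpace Y] {q : X → Y} (hq : Continuous q) {f : ℕ → ι → X} {g : ι → X}
    (h : TendstoUniformly f g atTop) :
    HausdorffTendsto (fun n => range fun i => q (f n i)) (range fun i => q (g i)) := by
  rintro m rfl
  have hu := (CompactSpace.uniformContinuous_of_continuous hq).comp_tendstoUniformly h
  rw [EMetric.tendstoUniformly_iff] at hu
  rw [ENNReal.tendsto_nhds_zero]
  intro ε hε
  filter_upwards [hu ε hε] with n hn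
  refine Metric.hausdorffEDist_le_of_mem_edist ?_ ?_
  · rintro _ ⟨i, rfl⟩
    exact ⟨_, ⟨i, rfl⟩, by rw [edist_comm]; exact (hn i).le⟩
  · rintro _ ⟨i, rfl⟩
    exact ⟨_, ⟨i, rfl⟩, (hn i).le⟩

theorem HausdorffTendsto.unique {Y : Type*} [TopologicalSpace Y]
    [TopologicalSpace.MetrizableSpace Y] {A : ℕ → Set Y} {B C : Set Y}
    (hB : HausdorffTendsto A B) (hC : HausdorffTendsto A C) (cB : IsClosed B) (cC : IsClosed C) :
    B = C := by
  let m := TopologicalSpace.metrizableSpaceMetric Y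
  have h1 := hB m rfl
  have h2 := hC m rfl
  rw [← cB.hausdorffEDist_zero_iff cC]
  refine le_antisymm (ge_of_tendsto' (by simpa using h1.add h2) fun n => ?_) bot_le
  rw [Metric.hausdorffEDist_comm (s := A n) (t := B)]
  exact Metric.hausdorffEDist_triangle

/-! ### Sequences on pairwise different legs -/

namespace IsRadial

variable {X : Set (ℝ × ℝ)} (hX : IsRadial X)

theorem slope_eq_of_mem_ray {x y : X} (hx : (x : ℝ × ℝ) ≠ 0) (h : x ∈ ray y) :
    slope hX.subset x = slope hX.subset y :=
  slope_eq_of_eq_smul hX.subset hx h.choose_spec.2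

theorem exists_seq_of_mem_closure_compl_ray (hc : IsCompact X) {a b : X}
    (hmax : ∀ y : X, slope hX.subset y = slope hX.subset a → y ∈ ray a)
    (hb0 : (b : ℝ × ℝ) ≠ 0) (hba : b ∈ ray a) (hb : b ∈ closure (ray a)ᶜ) :
    ∃ x e : ℕ → X, (fun k => slope hX.subset (e k)).Injective ∧
      (∀ k, (e k : ℝ × ℝ) ≠ 0 ∧ e k ∈ endPoints X ∧ e k ∉ ray a ∧ x k ∈ ray (e k) ∧
        (x k : ℝ × ℝ) ≠ 0 ∧ x k ≠ e k) ∧ Tendsto x atTop (𝓝 b) := by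
  obtain ⟨y, hy, hyb⟩ := mem_closure_iff_seq_limit.1 hb
  have y0 : ∀ k, (y k : ℝ × ℝ) ≠ 0 := fun k h =>
    hy k ⟨0, by norm_num, by rw [h, zero_smul]⟩
  have hsl : Tendsto (fun k => slope hX.subset (y k)) atTop (𝓝 (slope hX.subset a)) := by
    rw [← hX.slope_eq_of_mem_ray hb0 hba]
    exact ((continuousOn_slope hX.subset).continuousAt (isOpen_ne_zero.mem_nhds hb0)).tendsto.comp
      hyb
  -- The distances to the slope of `a` are positive and tend to `0`. A subsequence with strictly
  -- increasing inverses has pairwise different slopes.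
  have hdist : Tendsto (fun k => (dist (slope hX.subset (y k)) (slope hX.subset a))⁻¹) atTop
      atTop := by
    refine tendsto_inv_nhdsGT_zero.comp (tendsto_nhdsWithin_iff.2
      ⟨tendsto_iff_dist_tendsto_zero.1 hsl, .of_forall fun k => dist_pos.2 fun h => ?_⟩)
    exact hy k (hmax _ h)
  obtain ⟨σ, hσ, hσ'⟩ := strictMono_subseq_of_tendsto_atTop hdist
  choose e he0 hes hemax using fun k => hX.exists_isMax hc (y0 (σ k))
  -- Shrinking by this factor keeps the points strictly below the end-points without changing the
  -- limit; `k + 2` makes the factor non-zero at `k = 0`.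
  have hr : ∀ k : ℕ, (1 - 1 / ((k : ℝ) + 2)) ∈ Ioo (0 : ℝ) 1 := fun k => by
    have : (0 : ℝ) < k + 2 := by positivity
    have h1 : 1 / ((k : ℝ) + 2) < 1 := by rw [div_lt_one this]; linarith
    have h2 : 0 < 1 / ((k : ℝ) + 2) := by positivity
    constructor <;> linarith
  have hye : ∀ k, y (σ k) ∈ ray (e k) := fun k => hemax k _ (hes k).symm
  refine ⟨fun k => ⟨(1 - 1 / ((k : ℝ) + 2)) • (y (σ k) : ℝ × ℝ),
    hX.smul_mem _ (y (σ k)).2 _ (Ioo_subset_Icc_self (hr k))⟩, e, ?_, fun k => ⟨he0 k,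
      hX.mem_endPoints_of_isMax (he0 k) (hemax k), fun h => ?_, ?_, ?_, fun h => ?_⟩, ?_⟩
  · intro j k hjk
    simp only [hes] at hjk
    refine hσ'.injective ?_
    simp only [Function.comp_apply, hjk]
  · refine hy (σ k) (hmax _ ?_)
    rw [← hes, hX.slope_eq_of_mem_ray (he0 k) h]
  · obtain ⟨t, ht, h⟩ := hye k
    refine ⟨(1 - 1 / ((k : ℝ) + 2)) * t, ⟨mul_nonneg (hr k).1.le ht.1,
      mul_le_one₀ (hr k).2.le ht.1 ht.2⟩, ?_⟩
    rw [mul_smul, ← h]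
  · exact smul_ne_zero (hr k).1.ne' (y0 _)
  · obtain ⟨t, ht, h'⟩ := hye k
    have h1 : ((1 - 1 / ((k : ℝ) + 2)) * t) • (e k : ℝ × ℝ) = (1 : ℝ) • (e k : ℝ × ℝ) := by
      rw [mul_smul, ← h', one_smul]
      exact congrArg Subtype.val h
    have h2 := smul_left_injective ℝ (he0 k) h1
    have h3 : (1 - 1 / ((k : ℝ) + 2)) * t ≤ 1 - 1 / ((k : ℝ) + 2) :=
      mul_le_of_le_one_right (hr k).1.le ht.2
    linarith [(hr k).2]
  · rw [tendsto_subtype_rng]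
    have h1 : Tendsto (fun k : ℕ => 1 - 1 / ((k : ℝ) + 2)) atTop (𝓝 1) := by
      have h2 : Tendsto (fun k : ℕ => 1 / ((k : ℝ) + 2)) atTop (𝓝 0) :=
        tendsto_const_nhds.div_atTop
          (tendsto_atTop_add_const_right _ _ tendsto_natCast_atTop_atTop)
      simpa using h2.const_sub 1
    have h3 := h1.smul ((tendsto_subtype_rng.1 hyb).comp hσ.tendsto_atTop)
    rwa [one_smul] at h3

theorem tendstoUniformly_path {x : ℕ → X} {b : X} (h : Tendsto x atTop (𝓝 b)) :
    TendstoUniformly (fun n => hX.path (x n)) (hX.path b) atTop := by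
  rw [Metric.tendstoUniformly_iff]
  intro ε hε
  filter_upwards [Metric.tendsto_nhds.1 h ε hε] with n hn t
  refine lt_of_le_of_lt ?_ hn
  rw [dist_comm (x n)]
  simp only [Subtype.dist_eq, path]
  refine (dist_smul_le (t : ℝ) (b : ℝ × ℝ) (x n)).trans ?_
  refine mul_le_of_le_one_left dist_nonneg ?_
  rw [Real.norm_of_nonneg t.2.1]
  exact t.2.2

/-! ### The folded space -/

variable {a : X}

theorem foldMap_eq_iff {x y : X} : foldMap X a x = foldMap X a y ↔
    x = y ∨ ∃ t ∈ Icc (0 : ℝ) 1, (x : ℝ × ℝ) = t • (a : ℝ × ℝ) ∧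
      (y : ℝ × ℝ) = (1 - t) • (a : ℝ × ℝ) :=
  Quotient.eq (r := foldSetoid X a)

theorem continuous_foldMap : Continuous (foldMap X a) := continuous_quotient_mk'

theorem isQuotientMap_foldMap : IsQuotientMap (foldMap X a) := isQuotientMap_quotient_mk'

theorem foldMap_surjective : (foldMap X a).Surjective := Quotient.mk_surjective

theorem foldMap_eq_foldMap_of_add_eq_one {x y : X} {s t : ℝ} (hx : (x : ℝ × ℝ) = s • (a : ℝ × ℝ))
    (hy : (y : ℝ × ℝ) = t • (a : ℝ × ℝ)) (hs : 0 ≤ s) (ht : 0 ≤ t) (hst : s + t = 1) :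
    foldMap X a x = foldMap X a y := by
  refine foldMap_eq_iff.2 (.inr ⟨s, ⟨hs, by linarith⟩, hx, ?_⟩)
  rw [hy, ← hst, add_sub_cancel_left]

theorem foldMap_eq_origin_iff (ha : (a : ℝ × ℝ) ≠ 0) {x : X} :
    foldMap X a x = foldMap X a hX.origin ↔ (x : ℝ × ℝ) = 0 ∨ x = a := by
  constructor
  · intro h
    rcases foldMap_eq_iff.1 h with rfl | ⟨t, -, hx, h0⟩
    · exact .inl rfl
    · rcases smul_eq_zero.1 (h0.symm : _ = (0 : ℝ × ℝ)) with h | h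
      · right
        refine Subtype.ext ?_
        rw [hx, ← sub_eq_zero.1 h, one_smul]
      · exact absurd h ha
  · rintro (h | rfl)
    · exact congrArg _ (Subtype.ext h)
    · exact foldMap_eq_foldMap_of_add_eq_one (s := 1) (t := 0) (one_smul _ _).symm
        (zero_smul _ _).symm zero_le_one le_rfl (by norm_num)

/-- Polynomial coordinates that are constant exactly on the classes of the folding relation. -/
theorem exists_foldCoord (ha : (a : ℝ × ℝ) ≠ 0)
    (hmax : ∀ y : X, slope hX.subset y = slope hX.subset a → y ∈ ray a) :
    ∃ F : X → ℝ × ℝ × ℝ, Continuous F ∧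
      ∀ x y, F x = F y ↔ foldMap X a x = foldMap X a y := by
  obtain ⟨c, hc⟩ : ∃ c : ℝ, c = slope hX.subset a := ⟨_, rfl⟩
  have ha2 := snd_pos hX.subset ha
  have ha1 : (a : ℝ × ℝ).1 = c * (a : ℝ × ℝ).2 := hc ▸ fst_eq hX.subset a
  -- The first coordinate vanishes exactly on the line through `a`. Off that line the second
  -- recovers the height; on it the third is `a.2 ^ 2 * (t * (1 - t))` at `t • a`, which determines
  -- `t` up to `t ↦ 1 - t`.
  refine ⟨fun x => ((x : ℝ × ℝ).1 - c * (x : ℝ × ℝ).2,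
    (x : ℝ × ℝ).2 * ((x : ℝ × ℝ).1 - c * (x : ℝ × ℝ).2),
    (x : ℝ × ℝ).2 * ((a : ℝ × ℝ).2 - (x : ℝ × ℝ).2)), by fun_prop, fun x y => ⟨fun h => ?_, ?_⟩⟩
  · simp only [Prod.mk.injEq] at h
    obtain ⟨h1, h2, h3⟩ := h
    by_cases hu : (x : ℝ × ℝ).1 - c * (x : ℝ × ℝ).2 = 0
    · have key : ∀ z : X, (z : ℝ × ℝ).1 - c * (z : ℝ × ℝ).2 = 0 → z ∈ ray a := by
        intro z hz
        by_cases hz0 : (z : ℝ × ℝ) = 0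
        · exact ⟨0, by norm_num, by rw [hz0, zero_smul]⟩
        refine hmax z (Subtype.ext (mul_right_cancel₀ (snd_pos hX.subset hz0).ne' ?_))
        rw [← fst_eq, ← hc]
        linarith
      obtain ⟨s, hs, hx⟩ := key x hu
      obtain ⟨t, ht, hy⟩ := key y (h1 ▸ hu)
      have h4 : (a : ℝ × ℝ).2 ^ 2 * ((s - t) * (1 - s - t)) = 0 := by
        rw [hx, hy] at h3
        simp only [Prod.smul_snd, smul_eq_mul] at h3
        linear_combination h3
      rcases mul_eq_zero.1 h4 with h | h
      · exact absurd h (pow_pos ha2 2).ne'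
      rcases mul_eq_zero.1 h with h | h
      · refine congrArg _ (Subtype.ext ?_)
        rw [hx, hy, sub_eq_zero.1 h]
      · exact foldMap_eq_foldMap_of_add_eq_one hx hy hs.1 ht.1 (by linarith)
    · rw [← h1] at h2
      have h5 := mul_right_cancel₀ hu h2
      rw [h5] at h1
      exact congrArg _ (Subtype.ext (Prod.ext (by linarith) h5))
  · intro h
    rcases foldMap_eq_iff.1 h with rfl | ⟨t, ht, hx, hy⟩
    · rfl
    · simp only [hx, hy, Prod.smul_fst, Prod.smul_snd, smul_eq_mul, ha1, Prod.mk.injEq]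
      refine ⟨by ring, by ring, by ring⟩

/-- The coordinates descend to a continuous injection of a compact space into a Hausdorff one, hence
an embedding. -/
theorem metrizableSpace_foldedSpace (hc : IsCompact X) (ha : (a : ℝ × ℝ) ≠ 0)
    (hmax : ∀ y : X, slope hX.subset y = slope hX.subset a → y ∈ ray a) :
    TopologicalSpace.MetrizableSpace (FoldedSpace X a) := by
  have : CompactSpace X := isCompact_iff_compactSpace.1 hc
  obtain ⟨F, hF, hFq⟩ := hX.exists_foldCoord ha hmax
  have cG : Continuous (Quotient.lift (s := foldSetoid X a) F fun x y h =>
    (hFq x y).2 (Quotient.sound h)) := hF.quotient_lift _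
  have iG : (Quotient.lift (s := foldSetoid X a) F fun x y h =>
      (hFq x y).2 (Quotient.sound h)).Injective := by
    intro z w h
    obtain ⟨x, rfl⟩ := foldMap_surjective z
    obtain ⟨y, rfl⟩ := foldMap_surjective w
    exact (hFq x y).1 h
  exact (cG.isClosedEmbedding iG).isEmbedding.metrizableSpace

open Classical in
/-- The slope on the folded space; both `0` and `a` are given the value `0`. -/
noncomputable def foldSlope (a : X) : FoldedSpace X a → cantorSet :=
  Quotient.lift (s := foldSetoid X a)
    (fun x => if x = a then ⟨0, zero_mem_cantorSet⟩ else slope hX.subset x) (by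
      have s0 : ∀ x : X, (x : ℝ × ℝ) = 0 → slope hX.subset x = ⟨0, zero_mem_cantorSet⟩ :=
        fun x hx => Subtype.ext (by simp [slope, hx])
      have key : ∀ x : X, (∃ t : ℝ, t ≠ 1 ∧ (x : ℝ × ℝ) = t • (a : ℝ × ℝ)) →
          (a : ℝ × ℝ) ≠ 0 → x ≠ a := by
        rintro x ⟨t, ht, hx⟩ ha rfl
        exact ht (smul_left_injective ℝ ha (hx.symm.trans (one_smul ℝ _).symm))
      rintro x y (rfl | ⟨t, ht, hx, hy⟩)
      · rfl
      by_cases ha : (a : ℝ × ℝ) = 0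
      · have : x = y := Subtype.ext (by rw [hx, hy, ha, smul_zero, smul_zero])
        rw [this]
      by_cases h0 : t = 0
      · subst h0
        rw [if_neg (key x ⟨0, by norm_num, hx⟩ ha), if_pos (Subtype.ext (by simpa using hy)),
          s0 x (by simpa using hx)]
      by_cases h1 : t = 1
      · subst h1
        rw [if_pos (Subtype.ext (by simpa using hx)), if_neg (key y ⟨0, by norm_num, by
          simpa using hy⟩ ha), s0 y (by simpa using hy)]
      have h1' : 1 - t ≠ 0 := fun h => h1 (by linarith)
      rw [if_neg (key x ⟨t, h1, hx⟩ ha), if_neg (key y ⟨1 - t, fun h => h0 (by linarith), hy⟩ ha),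
        slope_eq_of_eq_smul hX.subset (by rw [hx]; exact smul_ne_zero h0 ha) hx,
        slope_eq_of_eq_smul hX.subset (by rw [hy]; exact smul_ne_zero h1' ha) hy])

theorem foldSlope_foldMap {x : X} (hx : x ≠ a) :
    hX.foldSlope a (foldMap X a x) = slope hX.subset x := if_neg hx

theorem continuousOn_foldSlope (hc : IsCompact X) (ha : (a : ℝ × ℝ) ≠ 0)
    (hmax : ∀ y : X, slope hX.subset y = slope hX.subset a → y ∈ ray a) :
    ContinuousOn (hX.foldSlope a) {foldMap X a hX.origin}ᶜ := by
  have := hX.metrizableSpace_foldedSpace hc ha hmax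
  rw [isQuotientMap_foldMap.continuousOn_isOpen_iff isOpen_compl_singleton]
  have hne : ∀ x ∈ foldMap X a ⁻¹' {foldMap X a hX.origin}ᶜ, (x : ℝ × ℝ) ≠ 0 ∧ x ≠ a := by
    intro x hx
    rw [mem_preimage, mem_compl_singleton_iff, Ne, hX.foldMap_eq_origin_iff ha] at hx
    exact not_or.1 hx
  exact ((continuousOn_slope hX.subset).mono fun x hx => (hne x hx).1).congr fun x hx =>
    hX.foldSlope_foldMap (hne x hx).2

/-- Distinct identified points `u • a` and `(1 - u) • a` cannot both have parameter at most `1 / 2`.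
-/
theorem injective_foldMap_path {x : X} (hx : (x : ℝ × ℝ) ≠ 0)
    (hhalf : ∀ s ∈ Icc (0 : ℝ) 1, ∀ y ∈ ray x, (y : ℝ × ℝ) = s • (a : ℝ × ℝ) → s ≤ 1 / 2) :
    (fun t => foldMap X a (hX.path x t)).Injective := by
  intro s t hst
  refine hX.path_injective hx ?_
  rcases foldMap_eq_iff.1 hst with h | ⟨u, hu, h1, h2⟩
  · exact h
  have m : ∀ t, hX.path x t ∈ ray x := fun t => hX.range_path x ▸ ⟨t, rfl⟩
  have h3 := hhalf u hu _ (m s) h1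
  have h4 := hhalf (1 - u) ⟨by linarith [hu.2], by linarith [hu.1]⟩ _ (m t) h2
  refine Subtype.ext ?_
  rw [h1, h2]
  congr 1
  linarith

theorem isArcBetween_image_ray [T2Space (FoldedSpace X a)] {x : X} (hx : (x : ℝ × ℝ) ≠ 0)
    (hhalf : ∀ s ∈ Icc (0 : ℝ) 1, ∀ y ∈ ray x, (y : ℝ × ℝ) = s • (a : ℝ × ℝ) → s ≤ 1 / 2) :
    IsArcBetween (foldMap X a '' ray x) (foldMap X a hX.origin) (foldMap X a x) := by
  have := isArcBetween_range (continuous_foldMap.comp (hX.continuous_path x))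
    (hX.injective_foldMap_path hx hhalf)
  rw [range_comp] at this
  simpa only [range_path, path_zero, path_one, Function.comp_apply] using this

theorem le_half_of_notMem_ray (ha : (a : ℝ × ℝ) ≠ 0)
    (hmax : ∀ y : X, slope hX.subset y = slope hX.subset a → y ∈ ray a) {x : X} (hx : x ∉ ray a) :
    ∀ s ∈ Icc (0 : ℝ) 1, ∀ y ∈ ray x, (y : ℝ × ℝ) = s • (a : ℝ × ℝ) → s ≤ 1 / 2 := by
  intro s hs y hy hya
  by_cases hy0 : (y : ℝ × ℝ) = 0
  · rw [hy0, eq_comm, smul_eq_zero, or_iff_left ha] at hya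
    rw [hya]
    norm_num
  · refine absurd (hmax x ?_) hx
    rw [← hX.slope_eq_of_mem_ray hy0 hy, slope_eq_of_eq_smul hX.subset hy0 hya]

theorem le_half_of_eq_smul (ha : (a : ℝ × ℝ) ≠ 0) {x : X} {r : ℝ} (hr : r ∈ Icc (0 : ℝ) (1 / 2))
    (hx : (x : ℝ × ℝ) = r • (a : ℝ × ℝ)) :
    ∀ s ∈ Icc (0 : ℝ) 1, ∀ y ∈ ray x, (y : ℝ × ℝ) = s • (a : ℝ × ℝ) → s ≤ 1 / 2 := by
  rintro s - y ⟨t, ht, hy⟩ hya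
  rw [hy, hx, smul_smul] at hya
  rw [← smul_left_injective ℝ ha hya]
  exact (mul_le_of_le_one_left hr.1 ht.2).trans hr.2

include hX in
/-- Every segment `[0, r • a]` with `1 / 2 ≤ r ≤ 1` covers the folded arc. -/
theorem image_ray_eq_foldedArc {x : X} {r : ℝ} (hr : r ∈ Icc (1 / 2 : ℝ) 1)
    (hx : (x : ℝ × ℝ) = r • (a : ℝ × ℝ)) : foldMap X a '' ray x = foldedArc X a := by
  refine subset_antisymm (image_mono ?_) ?_
  · rintro y ⟨t, ht, hy⟩
    refine ⟨t * r, ⟨mul_nonneg ht.1 (by linarith [hr.1]),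
      mul_le_one₀ ht.2 (by linarith [hr.1]) hr.2⟩, ?_⟩
    rw [hy, hx, smul_smul]
  · rintro _ ⟨y, ⟨t, ht, hy⟩, rfl⟩
    have hr0 : 0 < r := by linarith [hr.1]
    have mem : ∀ z : X, ∀ u : ℝ, 0 ≤ u → u ≤ r → (z : ℝ × ℝ) = u • (a : ℝ × ℝ) → z ∈ ray x := by
      intro z u h0 hu hz
      refine ⟨u / r, ⟨div_nonneg h0 hr0.le, (div_le_one hr0).2 hu⟩, ?_⟩
      rw [hz, hx, smul_smul, div_mul_cancel₀ _ hr0.ne']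
    rcases le_total t r with h | h
    · exact ⟨y, mem y t ht.1 h hy, rfl⟩
    · refine ⟨⟨(1 - t) • (a : ℝ × ℝ), hX.smul_mem _ a.2 _ ⟨by linarith [ht.2], by linarith [ht.1]⟩⟩,
        mem _ (1 - t) (by linarith [ht.2]) (by linarith [hr.1]) rfl, ?_⟩
      exact foldMap_eq_foldMap_of_add_eq_one rfl hy (by linarith [ht.2]) ht.1 (by ring)

/-- The leg in the quotient is the image of a segment `[0, e]`: `e` is `1/2 • a` on the folded leg
and the highest point of the given slope on any other. -/
theorem isLegSystem (hc : IsCompact X) (ha : (a : ℝ × ℝ) ≠ 0)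
    (hmax : ∀ y : X, slope hX.subset y = slope hX.subset a → y ∈ ray a) :
    IsLegSystem (foldMap X a hX.origin) (hX.foldSlope a) := by
  refine ⟨hX.continuousOn_foldSlope hc ha hmax, fun z hz => ?_⟩
  obtain ⟨x, rfl⟩ := foldMap_surjective z
  rw [Ne, hX.foldMap_eq_origin_iff ha, not_or] at hz
  suffices h : ∃ e : X, (e : ℝ × ℝ) ≠ 0 ∧
      (∀ s ∈ Icc (0 : ℝ) 1, ∀ y ∈ ray e, (y : ℝ × ℝ) = s • (a : ℝ × ℝ) → s ≤ 1 / 2) ∧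
      slope hX.subset e = slope hX.subset x ∧
      ∀ y : X, slope hX.subset y = slope hX.subset x → foldMap X a y ∈ foldMap X a '' ray e by
    obtain ⟨e, he0, hhalf, hes, hcov⟩ := h
    refine ⟨_, continuous_foldMap.comp (hX.continuous_path e),
      hX.injective_foldMap_path he0 hhalf, congrArg _ (hX.path_zero e), ?_⟩
    rw [range_comp, hX.range_path]
    ext w
    rw [hX.foldSlope_foldMap hz.2]
    constructor
    · rintro ⟨y, hy, rfl⟩
      by_cases hy0 : (y : ℝ × ℝ) = 0
      · exact .inl ((hX.foldMap_eq_origin_iff ha).2 (.inl hy0))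
      right
      rw [hX.foldSlope_foldMap, hX.slope_eq_of_mem_ray hy0 hy, hes]
      rintro rfl
      have := hhalf 1 ⟨zero_le_one, le_rfl⟩ _ hy (one_smul _ _).symm
      norm_num at this
    · intro hw
      by_cases hwo : w = foldMap X a hX.origin
      · rw [hwo]
        exact ⟨_, ⟨0, by norm_num, (zero_smul _ _).symm⟩, rfl⟩
      obtain ⟨y, rfl⟩ := foldMap_surjective w
      have hy := hw.resolve_left hwo
      rw [hX.foldMap_eq_origin_iff ha, not_or] at hwo
      rw [hX.foldSlope_foldMap hwo.2] at hy
      exact hcov y hy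
  by_cases hxa : x ∈ ray a
  · have hxs := hX.slope_eq_of_mem_ray hz.1 hxa
    have hm0 : (1 / 2 : ℝ) • (a : ℝ × ℝ) ≠ 0 := smul_ne_zero (by norm_num) ha
    refine ⟨⟨(1 / 2 : ℝ) • (a : ℝ × ℝ), hX.smul_mem _ a.2 _ (by norm_num)⟩, hm0,
      le_half_of_eq_smul ha (by norm_num) rfl, ?_, fun y hy => ?_⟩
    · rw [hxs]
      exact slope_eq_of_eq_smul hX.subset hm0 rfl
    · rw [hX.image_ray_eq_foldedArc (r := 1 / 2) (by norm_num) rfl]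
      exact ⟨y, hmax y (hy.trans hxs), rfl⟩
  · obtain ⟨e, he0, hes, hemax⟩ := hX.exists_isMax hc hz.1
    refine ⟨e, he0, hX.le_half_of_notMem_ray ha hmax fun h => hxa (hmax x ?_), hes,
      fun y hy => ⟨y, hemax y (hy.trans hes.symm), rfl⟩⟩
    rw [← hes, hX.slope_eq_of_mem_ray he0 h]

end IsRadial

/-! ### The main theorem -/

/-- A fan with a top in the Cantor fan is radial and has its top at the origin. -/
theorem IsFanWithTop.isRadial {X : Set (ℝ × ℝ)} (hX : X ⊆ cantorFan) {v : X}
    (hv : IsFanWithTop X v) : (v : ℝ × ℝ) = 0 ∧ IsRadial X := by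
  have h0 := hv.2.coe_eq_zero hX
  exact ⟨h0, isRadial_of_isDendroid hX hv.1.1 (h0 ▸ v.2)⟩

theorem IsLeg.eq_ray {X : Set (ℝ × ℝ)} (hX : IsRadial X) {A : Set X} (hA : IsLeg A) {a : X}
    (ha : endPoints X ∩ A = {a}) : A = ray a ∧ a ∈ endPoints X ∧ (a : ℝ × ℝ) ≠ 0 := by
  obtain ⟨v, e, hv, he, rfl⟩ := hA
  have hvo : v = hX.origin := Subtype.ext (hv.2.coe_eq_zero hX.subset)
  have hd := hv.1.1
  rw [hvo, hd.arc_eq (hX.isArcBetween_ray e)] at ha ⊢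
  have hea : e = a := by
    have : e ∈ endPoints X ∩ ray e := ⟨he, IsRadial.mem_ray_self e⟩
    rwa [ha] at this
  subst hea
  -- If `a` were the origin, it would be the top, and a ramification point is never an end-point.
  refine ⟨rfl, he, fun h => hv.2.notMem_endPoints ?_⟩
  rwa [hvo, show hX.origin = e from Subtype.ext h.symm]

end FoldedFan

theorem mainTheorem4
    (X : Set (ℝ × ℝ)) (hXF : X ⊆ cantorFan) (hX : IsSmoothFan X)
    (φ : X ≃ₜ X) (hφ : IsTransitiveMap φ)
    (A : Set X) (hA : IsLeg A) (hfix : ∀ x ∈ A, φ x = x)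
    (a : X) (ha : endPoints X ∩ A = {a}) :
    IsFan (FoldedSpace X a) ∧ ¬ IsSmoothFan (FoldedSpace X a) ∧
    ∃ o b m : X,
      (o : ℝ × ℝ) = (0, 0) ∧
      (b : ℝ × ℝ) = (3 / 4 : ℝ) • (a : ℝ × ℝ) ∧
      (m : ℝ × ℝ) = (1 / 2 : ℝ) • (a : ℝ × ℝ) ∧
      -- `q o` is the top of the fan `J`, and `q b` is an interior point of the arc `L_a`
      IsFanWithTop (FoldedSpace X a) (foldMap X a o) ∧
      IsArcBetween (foldedArc X a) (foldMap X a o) (foldMap X a m) ∧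
      foldMap X a b ∈ foldedArc X a \ {foldMap X a o, foldMap X a m} ∧
      arc (foldMap X a o) (foldMap X a b) ⊂ foldedArc X a ∧
      -- points in the interiors of pairwise different other legs converge to `b`
      (∃ x e : ℕ → X, Function.Injective e ∧
        (∀ k, e k ∈ endPoints X \ {a} ∧ x k ∈ arc o (e k) \ {o, e k}) ∧
        Tendsto x atTop (𝓝 b)) ∧
      -- the behaviour of any sequence on the other legs that converges to `b`
      ∀ x : ℕ → X, (∀ k, x k ∉ A) → Tendsto x atTop (𝓝 b) →
        Tendsto (fun k => foldMap X a (x k)) atTop (𝓝 (foldMap X a b)) ∧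
        HausdorffTendsto (fun k => arc (foldMap X a o) (foldMap X a (x k))) (foldedArc X a) ∧
        ¬ HausdorffTendsto (fun k => arc (foldMap X a o) (foldMap X a (x k)))
          (arc (foldMap X a o) (foldMap X a b)) := by
  obtain ⟨v, hv, -⟩ := hX
  have hR := (hv.isRadial hXF).2
  have hdX := hv.1.1
  have : CompactSpace X := hdX.1.2.1
  have hc : IsCompact X := isCompact_iff_compactSpace.2 this
  obtain ⟨rfl, hae, ha0⟩ := hA.eq_ray hR ha
  have hmax : ∀ y : X, slope hR.subset y = slope hR.subset a → y ∈ ray a := fun y hy =>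
    hR.mem_ray_of_mem_endPoints hae ha0 hy
  have hmet := hR.metrizableSpace_foldedSpace hc ha0 hmax
  have hL := hR.isLegSystem hc ha0 hmax
  have hfan : IsFan (FoldedSpace X a) := hL.isFan
  -- the points `t • a`
  set pt : unitInterval → X := hR.path a with hpt
  let b : X := pt ⟨3 / 4, by norm_num⟩
  let m : X := pt ⟨1 / 2, by norm_num⟩
  -- The partner of `b` under the folding. As `1/4 ≤ 1/2`, the segment `[0, b']` is mapped
  -- injectively, so its image is the arc from the top to the image of `b`.
  let b' : X := pt ⟨1 / 4, by norm_num⟩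
  have hb : (b : ℝ × ℝ) = (3 / 4 : ℝ) • (a : ℝ × ℝ) := rfl
  have hm : (m : ℝ × ℝ) = (1 / 2 : ℝ) • (a : ℝ × ℝ) := rfl
  have hb' : (b' : ℝ × ℝ) = (1 / 4 : ℝ) • (a : ℝ × ℝ) := rfl
  have hb0 : (b : ℝ × ℝ) ≠ 0 := smul_ne_zero (by norm_num) ha0
  have hm0 : (m : ℝ × ℝ) ≠ 0 := smul_ne_zero (by norm_num) ha0
  have hb0' : (b' : ℝ × ℝ) ≠ 0 := smul_ne_zero (by norm_num) ha0
  have inj : ∀ {s t : ℝ}, s • (a : ℝ × ℝ) = t • (a : ℝ × ℝ) → s = t := fun h =>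
    smul_left_injective ℝ ha0 h
  have hba : b ∈ ray a := ⟨3 / 4, by norm_num, rfl⟩
  have hqb : foldMap X a b' = foldMap X a b :=
    IsRadial.foldMap_eq_foldMap_of_add_eq_one hb' hb (by norm_num) (by norm_num) (by norm_num)
  -- arcs in the folded space
  have hbo : foldMap X a b ≠ foldMap X a hR.origin := by
    rw [Ne, hR.foldMap_eq_origin_iff ha0, not_or]
    refine ⟨hb0, fun h => ?_⟩
    have := inj ((hb.symm.trans (congrArg Subtype.val h)).trans (one_smul ℝ _).symm)
    norm_num at this
  -- The point `1/2 • a` is alone in its class, so the arc to the image of `b` misses this end-point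
  -- of the folded arc.
  have hmb : ∀ y ∈ ray b', foldMap X a y ≠ foldMap X a m := by
    rintro y ⟨t, ht, hy⟩ h
    rw [hb', smul_smul] at hy
    rcases IsRadial.foldMap_eq_iff.1 h with rfl | ⟨u, hu, h1, h2⟩
    · have := inj (hm.symm.trans hy)
      linarith [ht.2]
    · have h3 := inj (hy.symm.trans h1)
      have h4 := inj (hm.symm.trans h2)
      linarith [ht.2]
  have arcL : IsArcBetween (foldedArc X a) (foldMap X a hR.origin) (foldMap X a m) := by
    rw [← hR.image_ray_eq_foldedArc (r := 1 / 2) (by norm_num) hm]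
    exact hR.isArcBetween_image_ray hm0
      (IsRadial.le_half_of_eq_smul ha0 (by norm_num) hm)
  have arcb : arc (foldMap X a hR.origin) (foldMap X a b) = foldMap X a '' ray b' := by
    rw [← hqb]
    exact hfan.1.arc_eq (hR.isArcBetween_image_ray hb0'
      (IsRadial.le_half_of_eq_smul ha0 (by norm_num) hb'))
  have hss : arc (foldMap X a hR.origin) (foldMap X a b) ⊂ foldedArc X a := by
    rw [arcb]
    refine ⟨image_mono ?_, fun h => ?_⟩
    · rintro y ⟨t, ht, hy⟩
      exact ⟨t * (1 / 4), ⟨by linarith [ht.1], by linarith [ht.2]⟩, by rw [hy, hb', smul_smul]⟩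
    · obtain ⟨y, hy, h'⟩ := h arcL.symm.left_mem
      exact hmb y hy h'
  have arcx : ∀ x ∉ ray a, arc (foldMap X a hR.origin) (foldMap X a x) = foldMap X a '' ray x := by
    intro x hx
    exact hfan.1.arc_eq (hR.isArcBetween_image_ray
      (fun h => hx ⟨0, by norm_num, by rw [h, zero_smul]⟩)
      (hR.le_half_of_notMem_ray ha0 hmax hx))
  have hseq : ∀ x : ℕ → X, (∀ k, x k ∉ ray a) → Tendsto x atTop (𝓝 b) →
      Tendsto (fun k => foldMap X a (x k)) atTop (𝓝 (foldMap X a b)) ∧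
      HausdorffTendsto (fun k => arc (foldMap X a hR.origin) (foldMap X a (x k)))
        (foldedArc X a) ∧
      ¬ HausdorffTendsto (fun k => arc (foldMap X a hR.origin) (foldMap X a (x k)))
        (arc (foldMap X a hR.origin) (foldMap X a b)) := by
    intro x hx hxb
    have key : HausdorffTendsto (fun k => arc (foldMap X a hR.origin) (foldMap X a (x k)))
        (foldedArc X a) := by
      have := hausdorffTendsto_range_comp (IsRadial.continuous_foldMap (a := a))
        (hR.tendstoUniformly_path hxb)
      have hr : ∀ y : X, range (fun t => foldMap X a (hR.path y t)) = foldMap X a '' ray y :=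
        fun y => by rw [← hR.range_path, ← range_comp]; rfl
      simp only [hr] at this
      -- The limit segment `[0, b]` passes `1/2 • a`, so its image is the whole folded arc.
      rw [hR.image_ray_eq_foldedArc (r := 3 / 4) (by norm_num) hb] at this
      simpa only [arcx _ (hx _)] using this
    refine ⟨(IsRadial.continuous_foldMap.tendsto b).comp hxb, key, fun h => hss.ne ?_⟩
    refine h.unique key ?_ arcL.isCompact.isClosed
    rw [arcb]
    exact (hR.isArcBetween_image_ray hb0'
      (IsRadial.le_half_of_eq_smul ha0 (by norm_num) hb')).isCompact.isClosed
  obtain ⟨x, e, hinj, hxe, hxb⟩ := hR.exists_seq_of_mem_closure_compl_ray hc hmax hb0 hba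
    (hR.mem_closure_compl_ray hφ ha0 hfix hba)
  have hxa : ∀ k, x k ∉ ray a := fun k h => by
    obtain ⟨he0, -, hea, hxk, hx0, -⟩ := hxe k
    refine hea (hmax _ ?_)
    rw [← hR.slope_eq_of_mem_ray hx0 hxk, hR.slope_eq_of_mem_ray hx0 h]
  have htop : IsFanWithTop (FoldedSpace X a) (foldMap X a hR.origin) := by
    have hne : ∀ k, e k ≠ a := fun k h => (hxe k).2.2.1 (h ▸ IsRadial.mem_ray_self _)
    have hneo : ∀ k, foldMap X a (e k) ≠ foldMap X a hR.origin := fun k => by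
      rw [Ne, hR.foldMap_eq_origin_iff ha0, not_or]
      exact ⟨(hxe k).1, hne k⟩
    have hsl : ∀ j k, j ≠ k →
        hR.foldSlope a (foldMap X a (e j)) ≠ hR.foldSlope a (foldMap X a (e k)) := by
      intro j k hjk
      rw [hR.foldSlope_foldMap (hne j), hR.foldSlope_foldMap (hne k)]
      exact hinj.ne hjk
    exact ⟨hfan, hL.isRamificationPoint (hneo 0) (hneo 1) (hneo 2) (hsl 0 1 (by norm_num))
      (hsl 0 2 (by norm_num)) (hsl 1 2 (by norm_num))⟩
  refine ⟨hfan, ?_, hR.origin, b, m, rfl, hb, hm, htop, arcL, ⟨⟨b, hba, rfl⟩, ?_⟩, hss,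
    ⟨x, e, fun j k hjk => hinj (congrArg _ hjk), fun k => ?_, hxb⟩, hseq⟩
  · rintro ⟨w, hw, hsm⟩
    -- Smoothness may be witnessed by any top, but the image of the origin is the only ramification
    -- point.
    rw [hL.eq_of_isRamificationPoint hw.2] at hsm
    obtain ⟨h1, -, h3⟩ := hseq x hxa hxb
    exact h3 (hsm _ _ h1)
  · rintro (h | h)
    · exact hbo h
    · exact hmb b' (IsRadial.mem_ray_self b') (hqb.trans h)
  · obtain ⟨he0, hee, hea, hxk, hx0, hne⟩ := hxe k
    rw [hdX.arc_eq (hR.isArcBetween_ray (e k))]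
    refine ⟨⟨hee, fun h => hea (h ▸ IsRadial.mem_ray_self _)⟩, hxk, ?_⟩
    rintro (h | h)
    · exact hx0 (congrArg Subtype.val h)
    · exact hne h
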